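/- **Proposition 4.1.** Let $M\ge 1$ and $N=4M-4$. Let $B_{M,N}$ be the set of points $([U,V],[X,Y])\in\mathbb P(\mathbb C^{M\times N}\times\mathbb C^{M\times N})\times\mathbb P(\mathbb C^{M\times M}_{\rm sym}\times\mathbb C^{M\times M}_{\rm skew})$ (where $\mathbb C^{M\times M}_{\rm sym}$ and $\mathbb C^{M\times M}_{\rm skew}$ are the spaces of symmetric and of skew-symmetric complex $M\times M$ matrices) such that $$\operatorname{rank}(X+iY)\le 2\quad\text{and}\quad u_n^TXu_n+v_n^TXv_n-2u_n^TYv_n=0\ \text{ for all } 1\le n\le N,$$ where $u_n,v_n$ are the $n$-th columns of $U,V$, and let $\pi_1$ be the projection $([U,V],[X,Y])\mapsto[U,V]$. Then there is a nonzero polynomial $P\in\mathbb R[u_{mn},v_{mn} : 1\le m\le M,\ 1\le n\le N]$ such that - $P$ vanishes on $\pi_1(B_{M,N})$, i.e. $P(U,V)=0$ for every pair $(U,V)\neq(0,0)$ of complex matrices with $[U,V]\in\pi_1(B_{M,N})$; - $P$ has total degree $2\cdot(4M-4)\cdot 3^{(M-2)^2}$; - for each $n=1,\dots,N$, $P$ has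 degree $2\cdot 3^{(M-2)^2}$ in the set of column variables $\{u_{mn},v_{mn} : m=1,\dots,M\}$. -/

import Mathlib

namespace PhaseRetrieval

open MvPolynomial

/-- The space of symmetric complex `M × M` matrices. -/
def symMatrices (M : ℕ) : Submodule ℂ (Matrix (Fin M) (Fin M) ℂ) where
  carrier := {A | A.transpose = A}
  add_mem' := by
    intro A B hA hB
    simp only [Set.mem_ofPred_eq] at hA hB ⊢
    rw [Matrix.transpose_add, hA, hB]
  zero_mem' := by simp
  smul_mem' := by
    intro c A hA
    simp only [Set.mem_ofPred_eq] at hA ⊢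
    rw [Matrix.transpose_smul, hA]

/-- The space of skew-symmetric complex `M × M` matrices. -/
def skewMatrices (M : ℕ) : Submodule ℂ (Matrix (Fin M) (Fin M) ℂ) where
  carrier := {A | A.transpose = -A}
  add_mem' := by
    intro A B hA hB
    simp only [Set.mem_ofPred_eq] at hA hB ⊢
    rw [Matrix.transpose_add, hA, hB, neg_add]
  zero_mem' := by simp
  smul_mem' := by
    intro c A hA
    simp only [Set.mem_ofPred_eq] at hA ⊢
    rw [Matrix.transpose_smul, hA, smul_neg]

/-- Pairs `(U, V)` of complex `M × N` matrices. -/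
abbrev FramePair (M N : ℕ) : Type :=
  Matrix (Fin M) (Fin N) ℂ × Matrix (Fin M) (Fin N) ℂ

/-- Pairs `(X, Y)` with `X` symmetric and `Y` skew-symmetric. -/
abbrev SymSkewPair (M : ℕ) : Type :=
  symMatrices M × skewMatrices M

/-- The defining conditions of the incidence variety, on representatives:
`rank (X + iY) ≤ 2` and `uₙᵀ X uₙ + vₙᵀ X vₙ - 2 uₙᵀ Y vₙ = 0` for every `n`, where `uₙ` and `vₙ`
are the `n`-th columns of `U` and `V`. -/
def IncidenceConditions {M N : ℕ} (w : FramePair M N) (z : SymSkewPair M) : Prop :=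
  ((z.1 : Matrix (Fin M) (Fin M) ℂ)
      + Complex.I • (z.2 : Matrix (Fin M) (Fin M) ℂ)).rank ≤ 2 ∧
  ∀ n : Fin N,
    w.1.col n ⬝ᵥ (z.1 : Matrix (Fin M) (Fin M) ℂ).mulVec (w.1.col n)
      + w.2.col n ⬝ᵥ (z.1 : Matrix (Fin M) (Fin M) ℂ).mulVec (w.2.col n)
      - 2 * (w.1.col n ⬝ᵥ (z.2 : Matrix (Fin M) (Fin M) ℂ).mulVec (w.2.col n)) = 0

/-- The conditions are invariant under scaling of either pair of matrices by a nonzero scalar. -/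
theorem incidenceConditions_smul {M N : ℕ} (w : FramePair M N) (z : SymSkewPair M)
    (a b : ℂˣ) : IncidenceConditions (a • w) (b • z) ↔ IncidenceConditions w z := by
  have ha : (a : ℂ) ≠ 0 := a.ne_zero
  have hb : (b : ℂ) ≠ 0 := b.ne_zero
  have hcol : ∀ (A : Matrix (Fin M) (Fin N) ℂ) (n : Fin N),
      ((a : ℂ) • A).col n = (a : ℂ) • A.col n := fun A n => rfl
  unfold IncidenceConditions
  refine and_congr ?_ (forall_congr' fun n => ?_)
  · have h : (((b • z).1 : symMatrices M) : Matrix (Fin M) (Fin M) ℂ)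
        + Complex.I • (((b • z).2 : skewMatrices M) : Matrix (Fin M) (Fin M) ℂ)
        = (b : ℂ) • ((z.1 : Matrix (Fin M) (Fin M) ℂ)
          + Complex.I • (z.2 : Matrix (Fin M) (Fin M) ℂ)) := by
      simp only [Units.smul_def, Prod.smul_fst, Prod.smul_snd, Submodule.coe_smul, smul_add]
      rw [smul_comm]
    rw [h]
    have hr : ∀ (c : ℂ) (A : Matrix (Fin M) (Fin M) ℂ), (c • A).rank ≤ A.rank := by
      intro c A
      have hc : c • A = (c • (1 : Matrix (Fin M) (Fin M) ℂ)) * A := by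
        rw [Matrix.smul_mul, Matrix.one_mul]
      rw [hc]
      exact Matrix.rank_mul_le_right _ _
    refine ⟨fun h2 => le_trans ?_ h2, fun h2 => le_trans (hr _ _) h2⟩
    have h3 := hr (b : ℂ)⁻¹ ((b : ℂ) • ((z.1 : Matrix (Fin M) (Fin M) ℂ)
          + Complex.I • (z.2 : Matrix (Fin M) (Fin M) ℂ)))
    rwa [inv_smul_smul₀ hb] at h3
  · simp only [Units.smul_def, Prod.smul_fst, Prod.smul_snd, Submodule.coe_smul, hcol,
      Matrix.smul_mulVec, Matrix.mulVec_smul, dotProduct_smul, smul_dotProduct, smul_eq_mul]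
    constructor
    · intro h
      apply mul_left_cancel₀ (mul_ne_zero hb (mul_ne_zero ha ha))
      rw [mul_zero, ← h]
      ring
    · intro h
      linear_combination ((b : ℂ) * ((a : ℂ) * (a : ℂ))) * h

/-- The incidence variety `B_{M,N}` inside
`ℙ(ℂ^{M×N} × ℂ^{M×N}) × ℙ(ℂ^{M×M}_sym × ℂ^{M×M}_skew)`. The choice of representatives is
immaterial, see `mk_mem_incidenceVariety`. -/
def incidenceVariety (M N : ℕ) :
    Set (Projectivization ℂ (FramePair M N) × Projectivization ℂ (SymSkewPair M)) :=
  {p | IncidenceConditions p.1.rep p.2.rep}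

theorem mk_mem_incidenceVariety {M N : ℕ} (w : FramePair M N) (hw : w ≠ 0)
    (z : SymSkewPair M) (hz : z ≠ 0) :
    (Projectivization.mk ℂ w hw, Projectivization.mk ℂ z hz) ∈ incidenceVariety M N ↔
      IncidenceConditions w z := by
  obtain ⟨a, ha⟩ := Projectivization.exists_smul_eq_mk_rep ℂ w hw
  obtain ⟨b, hb⟩ := Projectivization.exists_smul_eq_mk_rep ℂ z hz
  change IncidenceConditions (Projectivization.mk ℂ w hw).rep
    (Projectivization.mk ℂ z hz).rep ↔ _
  rw [← ha, ← hb]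
  exact incidenceConditions_smul w z a b

/-- The projection `π₁(B_{M,N})` of the incidence variety to `ℙ(ℂ^{M×N} × ℂ^{M×N})`. -/
def projectedVariety (M N : ℕ) : Set (Projectivization ℂ (FramePair M N)) :=
  Prod.fst '' incidenceVariety M N

/-- Index set of the `2MN` variables: `Sum.inl (m, n)` is `u_{mn}`, `Sum.inr (m, n)` is
`v_{mn}`. -/
abbrev EntryVar (M N : ℕ) : Type := (Fin M × Fin N) ⊕ (Fin M × Fin N)

/-- The value of each variable at a pair `(U, V)`. -/
def entries {M N : ℕ} (w : FramePair M N) : EntryVar M N → ℂ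
  | Sum.inl (m, n) => w.1 m n
  | Sum.inr (m, n) => w.2 m n

/-- A real polynomial vanishes at a point of `ℙ(ℂ^{M×N} × ℂ^{M×N})` if it vanishes at every pair
`(U, V)` of complex matrices representing that point. -/
def VanishesAt {M N : ℕ} (P : MvPolynomial (EntryVar M N) ℝ)
    (p : Projectivization ℂ (FramePair M N)) : Prop :=
  ∀ (w : FramePair M N) (hw : w ≠ 0), Projectivization.mk ℂ w hw = p → aeval (entries w) P = 0

/-- The weight which is `1` on the variables `u_{mn}, v_{mn}` (`1 ≤ m ≤ M`) of column `n` and `0`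
on all other variables. -/
def columnWeight {M N : ℕ} (n : Fin N) : EntryVar M N → ℕ
  | Sum.inl (_, k) => if k = n then 1 else 0
  | Sum.inr (_, k) => if k = n then 1 else 0

/-- The degree of a polynomial in the set of variables `{u_{mn}, v_{mn} : 1 ≤ m ≤ M}` of
column `n`. -/
noncomputable def columnDegree {M N : ℕ} (n : Fin N) (P : MvPolynomial (EntryVar M N) ℝ) : ℕ :=
  weightedTotalDegree (columnWeight n) P

end PhaseRetrieval

/-! Put $Q=X+iY$, $a_n=u_n+iv_n$, $b_n=u_n-iv_n$. Because $X$ is symmetric and $Y$ is skew, the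
incidence equations become $b_n^TQa_n=0$, and $Q=0$ only when $X=Y=0$. So the task is to find a
polynomial vanishing whenever the $N$ forms $Q\mapsto b_n^TQa_n$ have a common nonzero zero of rank
at most two (`HasLowRankSolution`). These matrices form a cone of dimension $4M-4=N$, so a
hypersurface is expected. The point is to bound its degree in every column at once.

The number $3^{(M-2)^2}$ bounds the dimension of a quotient ring at one special frame. For
Vandermonde columns (`exists_diagonalRelations`) the forms become two linear relations on each
diagonal of $Q$. Together with the $3\times3$ minors, these rewrite every polynomial in the entries
as a combination of monomials in the $(M-2)^2$ entries outside the first two rows and columns, with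
exponents at most two (`DiagonalRelations.aeval_mem_reducedSpan`).

For each $n_0$ this yields a Macaulay-type determinant vanishing on the locus
(`exists_columnDegree_le`). It is nonzero because it is nonzero at the special frame. At most
$3^{(M-2)^2}$ of its columns involve the $n_0$-th form, and each of these is quadratic in frame
column $n_0$. Its degrees in the other frame columns are not controlled.

The different determinants are compared through a common divisor. The vanishing ideal of the locus
is prime, since a polynomial map parametrizes a dense part of the locus (`paramIdeal`). It contains
no nonzero polynomial omitting one chosen variable (`eq_zero_of_rename_mem_paramIdeal`), hence it is
principal (`exists_generator_of_isPrime`). Its generator divides all the determinants and so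
satisfies the bound in every column. A multihomogeneous component, the real or imaginary part of its
coefficients, and multiplication by powers of $u_{1n}$ give the required polynomial. -/

namespace PhaseRetrieval

open MvPolynomial

/-! ### Reduction to monomials in the inner entries by means of diagonals -/

section DiagonalReduction

variable {M : ℕ} {C : Type*} [CommRing C]

/-- The entry of `x` in row `i` on the diagonal `j - i = d`, or `0` if there is none. -/
def diagEntry (x : Fin M → Fin M → C) (d : ℤ) (i : Fin M) : C :=
  ∑ j : Fin M, if (j : ℤ) - i = d then x i j else 0

theorem diagEntry_eq (x : Fin M → Fin M → C) {d : ℤ} {i j : Fin M} (h : (j : ℤ) - i = d) :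
    diagEntry x d i = x i j := by
  unfold diagEntry
  rw [Finset.sum_eq_single j]
  · simp [h]
  · intro k _ hk
    rw [if_neg]
    intro h'
    apply hk
    ext
    omega
  · simp

theorem diagEntry_eq_zero (x : Fin M → Fin M → C) {d : ℤ} {i : Fin M}
    (h : ∀ j : Fin M, (j : ℤ) - i ≠ d) : diagEntry x d i = 0 :=
  Finset.sum_eq_zero fun j _ => if_neg (h j)

variable [Algebra ℂ C]

/-- The span of the entries on a diagonal. -/
def diagSpan (x : Fin M → Fin M → C) (d : ℤ) : Submodule ℂ C :=
  Submodule.span ℂ (Set.range (diagEntry x d))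

/-- The span of the entries on a diagonal lying outside the first two rows and columns. -/
def innerDiagSpan (x : Fin M → Fin M → C) (d : ℤ) : Submodule ℂ C :=
  Submodule.span ℂ {c | ∃ i j : Fin M, 2 ≤ (i : ℕ) ∧ 2 ≤ (j : ℕ) ∧ (j : ℤ) - i = d ∧ c = x i j}

theorem mem_diagSpan (x : Fin M → Fin M → C) {d : ℤ} {i j : Fin M} (h : (j : ℤ) - i = d) :
    x i j ∈ diagSpan x d := by
  rw [← diagEntry_eq x h]
  exact Submodule.subset_span ⟨i, rfl⟩

/-- Every diagonal of `x` satisfies the parity checks of a code of minimum distance three, and all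
`3 × 3` minors of `x` vanish. -/
structure DiagonalRelations (x : Fin M → Fin M → C) : Prop where
  sum_eq_zero : ∀ d, ∑ i, diagEntry x d i = 0
  weighted_sum_eq_zero : ∀ d, ∑ i : Fin M, (2 : ℂ) ^ (i : ℕ) • diagEntry x d i = 0
  det_eq_zero : ∀ r c : Fin 3 → Fin M, (Matrix.of fun p q => x (r p) (c q)).det = 0

variable {x : Fin M → Fin M → C}

/-- Subtracting $2^q$ times the plain relation from the weighted one removes the entry in row `q`
and keeps a nonzero coefficient at `p`. Since `q` is a natural number, it may also lie beyond the
last row. -/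
theorem DiagonalRelations.diagEntry_mem_span (hx : DiagonalRelations x) (d : ℤ) (p : Fin M)
    (q : ℕ) (hq : (p : ℕ) ≠ q) :
    diagEntry x d p ∈
      Submodule.span ℂ (diagEntry x d '' {i : Fin M | i ≠ p ∧ (i : ℕ) ≠ q}) := by
  set W := Submodule.span ℂ (diagEntry x d '' {i : Fin M | i ≠ p ∧ (i : ℕ) ≠ q})
  have h : ∑ i : Fin M, ((2 : ℂ) ^ (i : ℕ) - 2 ^ q) • diagEntry x d i = 0 := by
    simp only [sub_smul, Finset.sum_sub_distrib, ← Finset.smul_sum]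
    rw [hx.weighted_sum_eq_zero, hx.sum_eq_zero, smul_zero, sub_zero]
  have hne : ((2 : ℂ) ^ (p : ℕ) - 2 ^ q) ≠ 0 := by
    rw [sub_ne_zero]
    intro h2
    apply hq
    have h3 : ((2 ^ (p : ℕ) : ℕ) : ℂ) = ((2 ^ q : ℕ) : ℂ) := by push_cast; exact h2
    exact Nat.pow_right_injective le_rfl (Nat.cast_injective h3)
  rw [← Finset.add_sum_erase _ _ (Finset.mem_univ p), add_eq_zero_iff_eq_neg] at h
  rw [← Submodule.smul_mem_iff W hne, h]
  refine W.neg_mem (W.sum_mem fun i hi => ?_)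
  by_cases hiq : (i : ℕ) = q
  · simp [hiq]
  · exact W.smul_mem _ (Submodule.subset_span ⟨i, ⟨Finset.ne_of_mem_erase hi, hiq⟩, rfl⟩)

/-- A diagonal meets the first two rows and columns only in its first two positions, which are in
rows $\max(-d,0)$ and $\max(-d,0)+1$. Each of these entries is expressed through the rest of the
diagonal with the other one omitted. -/
theorem DiagonalRelations.diagSpan_le_innerDiagSpan (hx : DiagonalRelations x) (d : ℤ) :
    diagSpan x d ≤ innerDiagSpan x d := by
  set i₀ : ℕ := (-d).toNat with hi₀
  have key : ∀ i : Fin M, (i : ℕ) ≠ i₀ → (i : ℕ) ≠ i₀ + 1 →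
      diagEntry x d i ∈ innerDiagSpan x d := by
    intro i h0 h1
    by_cases h : ∃ j : Fin M, (j : ℤ) - i = d
    · obtain ⟨j, hj⟩ := h
      rw [diagEntry_eq x hj]
      refine Submodule.subset_span ⟨i, j, ?_, ?_, hj, rfl⟩ <;> omega
    · push Not at h
      rw [diagEntry_eq_zero x h]
      exact Submodule.zero_mem _
  refine Submodule.span_le.2 ?_
  rintro _ ⟨i, rfl⟩
  by_cases h0 : (i : ℕ) = i₀
  · refine Submodule.span_le.2 ?_ (hx.diagEntry_mem_span d i (i₀ + 1) (by omega))
    rintro _ ⟨k, ⟨hk1, hk2⟩, rfl⟩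
    refine key k (fun h => hk1 (Fin.ext ?_)) hk2
    omega
  · by_cases h1 : (i : ℕ) = i₀ + 1
    · refine Submodule.span_le.2 ?_ (hx.diagEntry_mem_span d i i₀ (by omega))
      rintro _ ⟨k, ⟨hk1, hk2⟩, rfl⟩
      refine key k hk2 (fun h => hk1 (Fin.ext ?_))
      omega
    · exact key i h0 h1

/-- The product is the main term of a $3\times3$ minor. Each of the other five terms permutes the
columns, which preserves the sum of the diagonal indices but moves some factor off diagonal `d`. -/
theorem DiagonalRelations.mul_mul_mem_of_ne (hx : DiagonalRelations x) (d : ℤ)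
    (T : Submodule ℂ C)
    (hT : ∀ d₁ d₂ d₃ : ℤ, d₁ + d₂ + d₃ = 3 * d → ¬(d₁ = d ∧ d₂ = d ∧ d₃ = d) →
      diagSpan x d₁ * diagSpan x d₂ * diagSpan x d₃ ≤ T)
    {a b c : Fin M} (hab : a ≠ b) (hac : a ≠ c) (hbc : b ≠ c) :
    diagEntry x d a * diagEntry x d b * diagEntry x d c ∈ T := by
  by_cases ha : ∃ j : Fin M, (j : ℤ) - a = d
  swap
  · push Not at ha
    simp [diagEntry_eq_zero x ha]
  by_cases hb : ∃ j : Fin M, (j : ℤ) - b = d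
  swap
  · push Not at hb
    simp [diagEntry_eq_zero x hb]
  by_cases hc : ∃ j : Fin M, (j : ℤ) - c = d
  swap
  · push Not at hc
    simp [diagEntry_eq_zero x hc]
  obtain ⟨ja, ha⟩ := ha
  obtain ⟨jb, hb⟩ := hb
  obtain ⟨jc, hc⟩ := hc
  rw [diagEntry_eq x ha, diagEntry_eq x hb, diagEntry_eq x hc]
  have hab' : (a : ℕ) ≠ b := fun h => hab (Fin.ext h)
  have hac' : (a : ℕ) ≠ c := fun h => hac (Fin.ext h)
  have hbc' : (b : ℕ) ≠ c := fun h => hbc (Fin.ext h)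
  have hmem : ∀ j₁ j₂ j₃ : Fin M, (j₁ : ℤ) + j₂ + j₃ = ja + jb + jc →
      ¬((j₁ : ℤ) = ja ∧ (j₂ : ℤ) = jb ∧ (j₃ : ℤ) = jc) → x a j₁ * x b j₂ * x c j₃ ∈ T := by
    intro j₁ j₂ j₃ hs hn
    refine hT ((j₁ : ℤ) - a) ((j₂ : ℤ) - b) ((j₃ : ℤ) - c) (by omega) (by omega) ?_
    exact Submodule.mul_mem_mul (Submodule.mul_mem_mul (mem_diagSpan x rfl) (mem_diagSpan x rfl))
      (mem_diagSpan x rfl)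
  have hdet := hx.det_eq_zero ![a, b, c] ![ja, jb, jc]
  rw [Matrix.det_fin_three] at hdet
  simp only [Matrix.of_apply, Matrix.cons_val_zero, Matrix.cons_val_one, Matrix.cons_val] at hdet
  have h1 := hmem ja jc jb (by omega) (by omega)
  have h2 := hmem jb ja jc (by omega) (by omega)
  have h3 := hmem jb jc ja (by omega) (by omega)
  have h4 := hmem jc ja jb (by omega) (by omega)
  have h5 := hmem jc jb ja (by omega) (by omega)
  have h6 : x a ja * x b jb * x c jc = x a ja * x b jc * x c jb + x a jb * x b ja * x c jc
      - x a jb * x b jc * x c ja - x a jc * x b ja * x c jb + x a jc * x b jb * x c ja := by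
    linear_combination hdet
  rw [h6]
  exact T.add_mem (T.sub_mem (T.sub_mem (T.add_mem h1 h2) h3) h4) h5

/-- Minors only treat three distinct rows. A repeated row is first replaced by a combination of
other rows, and excluding two rows at a time is exactly what the two relations on the diagonal
permit. -/
theorem DiagonalRelations.diagSpan_cube_le (hx : DiagonalRelations x) (d : ℤ)
    (T : Submodule ℂ C)
    (hT : ∀ d₁ d₂ d₃ : ℤ, d₁ + d₂ + d₃ = 3 * d → ¬(d₁ = d ∧ d₂ = d ∧ d₃ = d) →
      diagSpan x d₁ * diagSpan x d₂ * diagSpan x d₃ ≤ T) :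
    diagSpan x d * diagSpan x d * diagSpan x d ≤ T := by
  have hlin : ∀ (u : C) (W : Set (Fin M)), (∀ i ∈ W, u * diagEntry x d i ∈ T) →
      ∀ v ∈ Submodule.span ℂ (diagEntry x d '' W), u * v ∈ T := by
    intro u W h v hv
    have : Submodule.span ℂ (diagEntry x d '' W) ≤ T.comap (LinearMap.mulLeft ℂ u) := by
      rw [Submodule.span_le]
      rintro _ ⟨i, hi, rfl⟩
      exact h i hi
    exact this hv
  have h2 : ∀ a b c : Fin M, a ≠ b → diagEntry x d a * diagEntry x d b * diagEntry x d c ∈ T := by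
    intro a b c hab
    have hab' : (a : ℕ) ≠ b := fun h => hab (Fin.ext h)
    by_cases hca : c = a
    · subst hca
      refine hlin _ _ (fun i hi => ?_) _ (hx.diagEntry_mem_span d c b hab')
      exact hx.mul_mul_mem_of_ne d T hT hab (Ne.symm hi.1) (fun h => hi.2 (by rw [h]))
    · by_cases hcb : c = b
      · subst hcb
        refine hlin _ _ (fun i hi => ?_) _ (hx.diagEntry_mem_span d c a hab'.symm)
        exact hx.mul_mul_mem_of_ne d T hT hab (fun h => hi.2 (by rw [h])) (Ne.symm hi.1)
      · exact hx.mul_mul_mem_of_ne d T hT hab (Ne.symm hca) (Ne.symm hcb)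
  have h3 : ∀ a b c : Fin M, diagEntry x d a * diagEntry x d b * diagEntry x d c ∈ T := by
    intro a b c
    by_cases hab : a = b
    · subst hab
      by_cases hac : a = c
      · subst hac
        -- No row has index `M`, so here only row `a` is excluded.
        refine hlin _ _ (fun i hi => ?_) _ (hx.diagEntry_mem_span d a M a.2.ne)
        rw [mul_right_comm]
        exact h2 _ _ _ (Ne.symm hi.1)
      · rw [mul_right_comm]
        exact h2 _ _ _ hac
    · exact h2 _ _ _ hab
  rw [diagSpan, Submodule.span_mul_span, Submodule.span_mul_span, Submodule.span_le]
  rintro _ ⟨_, ⟨_, ⟨a, rfl⟩, _, ⟨b, rfl⟩, rfl⟩, _, ⟨c, rfl⟩, rfl⟩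
  exact h3 a b c

/-- Monomials in the entries outside the first two rows and columns. -/
def innerMonomial (x : Fin M → Fin M → C) (e : Fin M × Fin M → ℕ) : C :=
  ∏ p : {p : Fin M × Fin M // 2 ≤ (p.1 : ℕ) ∧ 2 ≤ (p.2 : ℕ)}, x p.1.1 p.1.2 ^ e p.1

/-- A matrix position lies on one diagonal only, so its exponent cannot exceed the multiplicity of
that diagonal in `s`. -/
theorem prod_innerDiagSpan_le (x : Fin M → Fin M → C) (s : Multiset ℤ) :
    (s.map (innerDiagSpan x)).prod ≤ Submodule.span ℂ (innerMonomial x ''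
      {e | ∀ p : Fin M × Fin M, e p ≤ s.count ((p.2 : ℤ) - p.1)}) := by
  induction s using Multiset.induction_on with
  | empty =>
    simp only [Multiset.map_zero, Multiset.prod_zero, Submodule.one_le]
    exact Submodule.subset_span ⟨0, by simp, by simp [innerMonomial]⟩
  | cons d s ih =>
    rw [Multiset.map_cons, Multiset.prod_cons]
    refine (mul_le_mul' le_rfl ih).trans ?_
    rw [innerDiagSpan, Submodule.span_mul_span]
    refine Submodule.span_mono ?_
    rintro _ ⟨_, ⟨i, j, hi, hj, hd, rfl⟩, _, ⟨e, he, rfl⟩, rfl⟩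
    refine ⟨e + Pi.single (i, j) 1, fun p => ?_, ?_⟩
    · rw [Multiset.count_cons, Pi.add_apply]
      refine add_le_add (he p) ?_
      by_cases hp : p = (i, j)
      · subst hp
        simp [hd]
      · rw [Pi.single_eq_of_ne hp]
        exact Nat.zero_le _
    · simp only [innerMonomial, Pi.add_apply, pow_add, Finset.prod_mul_distrib]
      rw [mul_comm]
      congr 1
      rw [Finset.prod_eq_single ⟨(i, j), hi, hj⟩]
      · simp
      · rintro p - hp
        rw [Pi.single_eq_of_ne, pow_zero]
        exact fun h => hp (Subtype.ext h)
      · simp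

/-- The span of the monomials in the inner entries with all exponents at most two. -/
def reducedSpan (x : Fin M → Fin M → C) : Submodule ℂ C :=
  Submodule.span ℂ (innerMonomial x '' {e | ∀ p, e p ≤ 2})

/-- Replacing a triple `d, d, d` by another triple with the same sum strictly increases the sum of
squares, which is bounded because diagonals with $|d|\ge M$ are empty. The process ends when every
multiplicity is at most two, and then each diagonal is replaced by its inner entries. -/
theorem DiagonalRelations.prod_diagSpan_le (hx : DiagonalRelations x) (s : Multiset ℤ) :
    (s.map (diagSpan x)).prod ≤ reducedSpan x := by
  -- The summand `1` keeps the measure positive while all diagonals satisfy $|d|<M$, so `toNat`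
  -- still drops strictly when the new triple makes it nonpositive.
  obtain ⟨n, hn⟩ : ∃ n : ℕ, (Multiset.card s * (M : ℤ) ^ 2 - (s.map (· ^ 2)).sum + 1).toNat = n :=
    ⟨_, rfl⟩
  induction n using Nat.strong_induction_on generalizing s with
  | _ n ih =>
  by_cases hbig : ∃ d ∈ s, (M : ℤ) ≤ |d|
  · obtain ⟨d, hd, hM⟩ := hbig
    obtain ⟨t, rfl⟩ := Multiset.exists_cons_of_mem hd
    have h0 : diagSpan x d = ⊥ := by
      rw [diagSpan, Submodule.span_eq_bot]
      rintro _ ⟨i, rfl⟩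
      refine diagEntry_eq_zero x fun j h => ?_
      rw [← h] at hM
      have := abs_lt.2 (⟨by omega, by omega⟩ : -(M : ℤ) < (j : ℤ) - i ∧ (j : ℤ) - i < M)
      omega
    rw [Multiset.map_cons, Multiset.prod_cons, h0, Submodule.bot_mul]
    exact bot_le
  push Not at hbig
  by_cases hc : ∃ d, 3 ≤ s.count d
  · obtain ⟨d, hd⟩ := hc
    rw [Multiset.le_count_iff_replicate_le] at hd
    obtain ⟨t, rfl⟩ := Multiset.le_iff_exists_add.1 hd
    have hrep : Multiset.replicate 3 d + t = d ::ₘ d ::ₘ d ::ₘ t := by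
      simp [Multiset.replicate_succ]
    rw [hrep] at hn hbig ⊢
    simp only [Multiset.map_cons, Multiset.prod_cons]
    rw [← mul_assoc, ← mul_assoc, ← Submodule.le_div_iff_mul_le]
    refine hx.diagSpan_cube_le d _ fun d₁ d₂ d₃ hsum hne => ?_
    rw [Submodule.le_div_iff_mul_le]
    have := ih _ ?_ (d₁ ::ₘ d₂ ::ₘ d₃ ::ₘ t) rfl
    · simpa only [Multiset.map_cons, Multiset.prod_cons, mul_assoc] using this
    rw [← hn]
    have hpos : (Multiset.map (fun a : ℤ => a ^ 2) (d ::ₘ d ::ₘ d ::ₘ t)).sum ≤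
        ((d ::ₘ d ::ₘ d ::ₘ t).card : ℤ) * M ^ 2 := by
      have := Multiset.sum_le_card_nsmul
        (Multiset.map (fun a : ℤ => a ^ 2) (d ::ₘ d ::ₘ d ::ₘ t)) ((M : ℤ) ^ 2) ?_
      · simpa using this
      intro y hy
      obtain ⟨a, ha, rfl⟩ := Multiset.mem_map.1 hy
      have := hbig a ha
      exact sq_le_sq' (by have := abs_lt.1 this; omega) (by have := abs_lt.1 this; omega)
    have hlt : 3 * d ^ 2 < d₁ ^ 2 + d₂ ^ 2 + d₃ ^ 2 := by
      obtain ⟨e₁, rfl⟩ : ∃ e, d₁ = d + e := ⟨d₁ - d, by ring⟩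
      obtain ⟨e₂, rfl⟩ : ∃ e, d₂ = d + e := ⟨d₂ - d, by ring⟩
      obtain rfl : d₃ = d - e₁ - e₂ := by linarith
      have h0 : 0 < e₁ ^ 2 + e₂ ^ 2 := by
        by_contra h
        have h1 : e₁ = 0 := by nlinarith [sq_nonneg e₁, sq_nonneg e₂]
        have h2 : e₂ = 0 := by nlinarith [sq_nonneg e₁, sq_nonneg e₂]
        exact hne (by simp [h1, h2])
      nlinarith [sq_nonneg (e₁ + e₂)]
    simp only [Multiset.map_cons, Multiset.sum_cons, Multiset.card_cons] at hpos ⊢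
    push_cast at hpos ⊢
    refine (Int.toNat_lt_toNat ?_).2 ?_ <;> linarith
  · push Not at hc
    have h1 : ∀ t : Multiset ℤ,
        (t.map (diagSpan x)).prod ≤ (t.map (innerDiagSpan x)).prod := by
      intro t
      induction t using Multiset.induction_on with
      | empty => simp
      | cons a t iht =>
        simp only [Multiset.map_cons, Multiset.prod_cons]
        exact mul_le_mul' (hx.diagSpan_le_innerDiagSpan a) iht
    refine ((h1 s).trans (prod_innerDiagSpan_le x s)).trans (Submodule.span_mono ?_)
    refine Set.image_mono fun e he p => (he p).trans ?_
    have := hc ((p.2 : ℤ) - p.1)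
    omega

theorem DiagonalRelations.aeval_mem_reducedSpan (hx : DiagonalRelations x)
    (p : MvPolynomial (Fin M × Fin M) ℂ) :
    aeval (fun ij : Fin M × Fin M => x ij.1 ij.2) p ∈ reducedSpan x := by
  induction p using MvPolynomial.induction_on' with
  | add p q hp hq =>
    rw [map_add]
    exact Submodule.add_mem _ hp hq
  | monomial m c =>
    rw [aeval_monomial, ← Algebra.smul_def]
    refine Submodule.smul_mem _ _ ?_
    refine hx.prod_diagSpan_le (m.toMultiset.map fun p => (p.2 : ℤ) - p.1) ?_
    rw [Multiset.map_map]
    have : ∀ t : Multiset (Fin M × Fin M),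
        (t.map fun p => x p.1 p.2).prod ∈
          (t.map (diagSpan x ∘ fun p : Fin M × Fin M => (p.2 : ℤ) - p.1)).prod := by
      intro t
      induction t using Multiset.induction_on with
      | empty => simp [Submodule.one_le.1 le_rfl]
      | cons a t iht =>
        simp only [Multiset.map_cons, Multiset.prod_cons]
        exact Submodule.mul_mem_mul (mem_diagSpan x rfl) iht
    have h2 : (m.toMultiset.map fun p => x p.1 p.2).prod = m.prod fun p k => x p.1 p.2 ^ k := by
      rw [Finsupp.toMultiset_map, Finsupp.prod_toMultiset, Finsupp.prod_mapDomain_index]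
      · simp
      · intros; rw [pow_add]
    rw [← h2]
    exact this _

end DiagonalReduction

end PhaseRetrieval

/-! ### The rank-two ideal and the special Vandermonde frame -/

namespace PhaseRetrieval

open MvPolynomial

/-- The evaluation of polynomials in the entries of a matrix. -/
noncomputable def matrixEval {M : ℕ} (Q : Matrix (Fin M) (Fin M) ℂ) :
    MvPolynomial (Fin M × Fin M) ℂ →+* ℂ :=
  eval fun p => Q p.1 p.2

/-- The vanishing ideal of the variety of matrices of rank at most two. -/
noncomputable def rankTwoIdeal (M : ℕ) : Ideal (MvPolynomial (Fin M × Fin M) ℂ) :=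
  ⨅ (Q : Matrix (Fin M) (Fin M) ℂ) (_ : Q.rank ≤ 2), RingHom.ker (matrixEval Q)

theorem mem_rankTwoIdeal {M : ℕ} {p : MvPolynomial (Fin M × Fin M) ℂ} :
    p ∈ rankTwoIdeal M ↔
      ∀ Q : Matrix (Fin M) (Fin M) ℂ, Q.rank ≤ 2 → matrixEval Q p = 0 := by
  simp [rankTwoIdeal, RingHom.mem_ker]

/-- The linear form `Q ↦ bₙᵀ Q aₙ`, where the columns `aₙ` and `bₙ` are given by `y`. -/
noncomputable def linForm {M N : ℕ} (y : EntryVar M N → ℂ) (n : Fin N) :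
    MvPolynomial (Fin M × Fin M) ℂ :=
  ∑ i, ∑ j, C (y (Sum.inr (i, n)) * y (Sum.inl (j, n))) * X (i, j)

theorem matrixEval_linForm {M N : ℕ} (y : EntryVar M N → ℂ) (n : Fin N)
    (Q : Matrix (Fin M) (Fin M) ℂ) :
    matrixEval Q (linForm y n) =
      ∑ i, ∑ j, y (Sum.inr (i, n)) * y (Sum.inl (j, n)) * Q i j := by
  simp [matrixEval, linForm]

theorem isHomogeneous_linForm {M N : ℕ} (y : EntryVar M N → ℂ) (n : Fin N) :
    (linForm y n).IsHomogeneous 1 :=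
  IsHomogeneous.sum _ _ _ fun _ _ => IsHomogeneous.sum _ _ _ fun _ _ => by
    exact isHomogeneous_C_mul_X _ _

/-- Invertibility of the Vandermonde matrix, transferred to vector coefficients by applying linear
functionals. -/
theorem eq_zero_of_forall_sum_pow_smul_eq_zero {V : Type*} [AddCommGroup V] [Module ℂ V] {n : ℕ}
    {f : Fin n → ℂ} (hf : Function.Injective f) {g : ℕ → V}
    (h : ∀ k, ∑ e ∈ Finset.range n, f k ^ e • g e = 0) {e : ℕ} (he : e < n) : g e = 0 := by
  rw [← Module.forall_dual_apply_eq_zero_iff ℂ]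
  intro φ
  have := Matrix.eq_zero_of_forall_index_sum_pow_mul_eq_zero hf (v := fun i : Fin n => φ (g i))
    (fun k => by
      have h2 := congrArg φ (h k)
      rw [map_zero, map_sum, ← Fin.sum_univ_eq_sum_range (fun e => φ (f k ^ e • g e))] at h2
      simpa using h2)
  exact congrFun this ⟨e, he⟩

/-- For $a_j=z^j$ and $b_i=c_iz^{M-1-i}$, the form $b^Txa$ is a polynomial in $z$ whose coefficients
are the weighted diagonal sums. The shift by $M-1$ makes all exponents nonnegative. -/
theorem sum_range_pow_smul_diagEntry {M : ℕ} {A : Type*} [CommRing A] [Algebra ℂ A]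
    (x : Fin M → Fin M → A) (c : Fin M → ℂ) (z : ℂ) :
    ∑ e ∈ Finset.range (2 * M - 1), z ^ e •
        ∑ i, c i • diagEntry x ((e : ℤ) - ((M - 1 : ℕ) : ℤ)) i =
      ∑ i : Fin M, ∑ j : Fin M, (c i * z ^ (M - 1 - (i : ℕ)) * z ^ (j : ℕ)) • x i j := by
  simp only [diagEntry, Finset.smul_sum, smul_ite, smul_zero]
  rw [Finset.sum_comm]
  refine Finset.sum_congr rfl fun i _ => ?_
  rw [Finset.sum_comm]
  refine Finset.sum_congr rfl fun j _ => ?_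
  have hi := i.2
  have hj := j.2
  rw [Finset.sum_eq_single (M - 1 - (i : ℕ) + j)]
  · rw [if_pos (by omega), smul_smul]
    congr 1
    ring
  · intro e _ he
    rw [if_neg (by omega)]
  · intro h
    rw [Finset.mem_range] at h
    omega

theorem quotientMk_C_mul {M : ℕ} (I : Ideal (MvPolynomial (Fin M × Fin M) ℂ)) (c : ℂ)
    (p : MvPolynomial (Fin M × Fin M) ℂ) :
    Ideal.Quotient.mk I (C c * p) = c • Ideal.Quotient.mk I p := by
  rw [← MvPolynomial.smul_eq_C_mul]
  rfl

/-- The residues of the coordinates modulo rank at most two and the linear conditions of `y`. -/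
noncomputable def coordResidue {M N : ℕ} (y : EntryVar M N → ℂ) (i j : Fin M) :
    MvPolynomial (Fin M × Fin M) ℂ ⧸ (rankTwoIdeal M ⊔ Ideal.span (Set.range (linForm y))) :=
  Ideal.Quotient.mk _ (X (i, j))

theorem det_coordResidue {M N : ℕ} (y : EntryVar M N → ℂ) (r c : Fin 3 → Fin M) :
    (Matrix.of fun p q => coordResidue y (r p) (c q)).det = 0 := by
  have h : (Matrix.of fun p q => (X (r p, c q) : MvPolynomial (Fin M × Fin M) ℂ)).det ∈
      rankTwoIdeal M := by
    rw [mem_rankTwoIdeal]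
    intro Q hQ
    rw [RingHom.map_det]
    have hs : (matrixEval Q).mapMatrix
        (Matrix.of fun p q => (X (r p, c q) : MvPolynomial (Fin M × Fin M) ℂ)) =
        Q.submatrix r c := by
      ext p q
      simp [matrixEval]
    rw [hs]
    by_contra hdet
    have h3 : (Q.submatrix r c).rank = 3 := by
      rw [Matrix.rank_of_isUnit _ ((Matrix.isUnit_iff_isUnit_det _).2 (Ne.isUnit hdet))]
      simp
    have := Matrix.rank_submatrix_le Q r c
    omega
  have h2 := (Ideal.Quotient.eq_zero_iff_mem
    (I := rankTwoIdeal M ⊔ Ideal.span (Set.range (linForm y)))).2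
    (Ideal.mem_sup_left h)
  rw [RingHom.map_det] at h2
  exact h2

theorem coordResidue_linForm {M N : ℕ} (y : EntryVar M N → ℂ) (n : Fin N) :
    ∑ i, ∑ j, (y (Sum.inr (i, n)) * y (Sum.inl (j, n))) • coordResidue y i j = 0 := by
  have h := (Ideal.Quotient.eq_zero_iff_mem
    (I := rankTwoIdeal M ⊔ Ideal.span (Set.range (linForm y)))).2
    (Ideal.mem_sup_right (Ideal.subset_span ⟨n, rfl⟩))
  rw [linForm, map_sum] at h
  simp only [map_sum, quotientMk_C_mul] at h
  exact h

/-- The column pairs `a = (zʲ)`, `b = (2^{s i} z^{M-1-i})` with `s = 0` for `2M-1` values of `z`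
and `s = 1` for `2M-3` values of `z`. -/
noncomputable def vandermondePoint (M : ℕ) : Fin ((2 * M - 1) + (2 * M - 3)) → Fin M → ℂ × ℂ :=
  Fin.addCases
    (fun z i => (((z : ℕ) + 1 : ℂ) ^ (i : ℕ), ((z : ℕ) + 1 : ℂ) ^ (M - 1 - (i : ℕ))))
    (fun z i => (((z : ℕ) + 1 : ℂ) ^ (i : ℕ),
      (2 : ℂ) ^ (i : ℕ) * ((z : ℕ) + 1 : ℂ) ^ (M - 1 - (i : ℕ))))

/-- The $2M-1$ diagonals need that many values of $z$ for the plain relations. The weighted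
relations need only $2M-3$, because each of the two corner diagonals has a single entry, already
killed by the plain relation. The total is exactly $4M-4$. -/
theorem exists_diagonalRelations {M : ℕ} (hM : 2 ≤ M) :
    ∃ y : EntryVar M (4 * M - 4) → ℂ, DiagonalRelations (coordResidue y) := by
  have hN : 4 * M - 4 = (2 * M - 1) + (2 * M - 3) := by omega
  refine ⟨Sum.elim (fun p => (vandermondePoint M (finCongr hN p.2) p.1).1)
    (fun p => (vandermondePoint M (finCongr hN p.2) p.1).2), ?_⟩
  set y : EntryVar M (4 * M - 4) → ℂ :=
    Sum.elim (fun p => (vandermondePoint M (finCongr hN p.2) p.1).1)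
    (fun p => (vandermondePoint M (finCongr hN p.2) p.1).2) with hy
  have hinj : ∀ m : ℕ, Function.Injective fun z : Fin m => ((z : ℕ) + 1 : ℂ) := by
    intro m a b hab
    exact Fin.ext (by exact_mod_cast add_right_cancel hab)
  have hout : ∀ d : ℤ, ¬(∃ e : ℕ, e < 2 * M - 1 ∧ d = (e : ℤ) - ((M - 1 : ℕ) : ℤ)) →
      ∀ i, diagEntry (coordResidue y) d i = 0 := by
    intro d hd i
    refine diagEntry_eq_zero _ fun j hj => hd ⟨(d + ((M - 1 : ℕ) : ℤ)).toNat, ?_, ?_⟩ <;> omega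
  have h0 : ∀ e < 2 * M - 1,
      ∑ i, diagEntry (coordResidue y) ((e : ℤ) - ((M - 1 : ℕ) : ℤ)) i = 0 := by
    intro e he
    have := eq_zero_of_forall_sum_pow_smul_eq_zero (hinj (2 * M - 1))
      (g := fun e => ∑ i, (1 : ℂ) • diagEntry (coordResidue y) ((e : ℤ) - ((M - 1 : ℕ) : ℤ)) i)
      (fun z => by
        rw [sum_range_pow_smul_diagEntry (coordResidue y) (fun _ => 1)]
        rw [← coordResidue_linForm y ((finCongr hN).symm (Fin.castAdd _ z))]
        refine Finset.sum_congr rfl fun i _ => Finset.sum_congr rfl fun j _ => ?_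
        simp [hy, vandermondePoint]) he
    simpa using this
  have h1 : ∀ e < 2 * M - 1, ∑ i : Fin M, (2 : ℂ) ^ (i : ℕ) •
      diagEntry (coordResidue y) ((e : ℤ) - ((M - 1 : ℕ) : ℤ)) i = 0 := by
    have hcorner : ∀ e < 2 * M - 1, ∀ i₀ : Fin M,
        (∀ i ≠ i₀, diagEntry (coordResidue y) ((e : ℤ) - ((M - 1 : ℕ) : ℤ)) i = 0) →
        ∑ i : Fin M, (2 : ℂ) ^ (i : ℕ) •
          diagEntry (coordResidue y) ((e : ℤ) - ((M - 1 : ℕ) : ℤ)) i = 0 := by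
      intro e he i₀ hi₀
      have := h0 e he
      rw [Finset.sum_eq_single i₀ (fun i _ hi => hi₀ i hi) (by simp)] at this
      refine Finset.sum_eq_zero fun i _ => ?_
      by_cases hi : i = i₀
      · rw [hi, this, smul_zero]
      · rw [hi₀ i hi, smul_zero]
    have hfirst := hcorner 0 (by omega) ⟨M - 1, by omega⟩ (fun i hi => by
      refine diagEntry_eq_zero _ fun j hj => hi (Fin.ext ?_)
      show (i : ℕ) = M - 1
      omega)
    have hlast := hcorner (2 * M - 2) (by omega) ⟨0, by omega⟩ (fun i hi => by
      refine diagEntry_eq_zero _ fun j hj => hi (Fin.ext ?_)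
      show (i : ℕ) = 0
      omega)
    -- With the two corner coefficients gone, the polynomial in $z$ is divisible by $z$. The
    -- quotient has $2M-3$ coefficients, and the nodes $z$ are nonzero.
    have hmid : ∀ e < 2 * M - 3, ∑ i : Fin M, (2 : ℂ) ^ (i : ℕ) •
        diagEntry (coordResidue y) (((e + 1 : ℕ) : ℤ) - ((M - 1 : ℕ) : ℤ)) i = 0 := by
      intro e he
      refine eq_zero_of_forall_sum_pow_smul_eq_zero (hinj (2 * M - 3))
        (g := fun e => ∑ i : Fin M, (2 : ℂ) ^ (i : ℕ) •
          diagEntry (coordResidue y) (((e + 1 : ℕ) : ℤ) - ((M - 1 : ℕ) : ℤ)) i) (fun z => ?_) he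
      have hsum := sum_range_pow_smul_diagEntry (coordResidue y)
        (fun i => (2 : ℂ) ^ (i : ℕ)) ((z : ℕ) + 1 : ℂ)
      have hsplit : 2 * M - 1 = (2 * M - 3) + 1 + 1 := by omega
      have hlast' : 2 * M - 2 = (2 * M - 3) + 1 := by omega
      rw [hsplit, Finset.sum_range_succ, Finset.sum_range_succ', ← hlast', hlast, hfirst,
        smul_zero, smul_zero, add_zero, add_zero] at hsum
      have hz : ((z : ℕ) + 1 : ℂ) ≠ 0 := Nat.cast_add_one_ne_zero _
      rw [← smul_right_injective _ hz |>.eq_iff, smul_zero, Finset.smul_sum]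
      rw [← coordResidue_linForm y ((finCongr hN).symm (Fin.natAdd _ z))]
      simp only [smul_smul, ← pow_succ']
      rw [hsum]
      refine Finset.sum_congr rfl fun i _ => Finset.sum_congr rfl fun j _ => ?_
      simp [hy, vandermondePoint]
    intro e he
    rcases Nat.eq_zero_or_pos e with rfl | hpos
    · exact hfirst
    · obtain ⟨e, rfl⟩ : ∃ e', e = e' + 1 := ⟨e - 1, by omega⟩
      by_cases hlt : e < 2 * M - 3
      · exact hmid e hlt
      · have hlast' : e + 1 = 2 * M - 2 := by omega
        rw [hlast']
        exact hlast
  refine ⟨fun d => ?_, fun d => ?_, det_coordResidue y⟩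
  · by_cases hd : ∃ e : ℕ, e < 2 * M - 1 ∧ d = (e : ℤ) - ((M - 1 : ℕ) : ℤ)
    · obtain ⟨e, he, rfl⟩ := hd
      exact h0 e he
    · exact Finset.sum_eq_zero fun i _ => hout d hd i
  · by_cases hd : ∃ e : ℕ, e < 2 * M - 1 ∧ d = (e : ℤ) - ((M - 1 : ℕ) : ℤ)
    · obtain ⟨e, he, rfl⟩ := hd
      exact h1 e he
    · exact Finset.sum_eq_zero fun i _ => by rw [hout d hd i, smul_zero]

end PhaseRetrieval

/-! ### Graded pieces and reduced monomials -/

namespace PhaseRetrieval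

open MvPolynomial

theorem eval_smul_eq_sum {σ : Type*} (p : MvPolynomial σ ℂ) (x : σ → ℂ) (t : ℂ) :
    eval (fun i => t * x i) p =
      ∑ k ∈ Finset.range (p.totalDegree + 1), eval x (homogeneousComponent k p) * t ^ k := by
  conv_lhs => rw [← sum_homogeneousComponent p]
  rw [map_sum]
  refine Finset.sum_congr rfl fun k _ => ?_
  rw [eval_eq, eval_eq, Finset.sum_mul]
  refine Finset.sum_congr rfl fun m hm => ?_
  have hk := homogeneousComponent_isHomogeneous k p (mem_support_iff.1 hm)
  replace hk : ∑ i ∈ m.support, m i = k := by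
    simpa [Finsupp.weight_apply, Finsupp.sum] using hk
  simp only [mul_pow, Finset.prod_mul_distrib]
  rw [Finset.prod_pow_eq_pow_sum]
  rw [hk]
  ring

/-- The rank locus is a cone, so $t\mapsto p(tQ)$ vanishes identically. Its coefficients are the
values at `Q` of the homogeneous components. -/
theorem homogeneousComponent_mem_rankTwoIdeal {M : ℕ} {p : MvPolynomial (Fin M × Fin M) ℂ}
    (hp : p ∈ rankTwoIdeal M) (k : ℕ) : homogeneousComponent k p ∈ rankTwoIdeal M := by
  rw [mem_rankTwoIdeal] at hp ⊢
  intro Q hQ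
  set h : Polynomial ℂ := ∑ k ∈ Finset.range (p.totalDegree + 1),
    Polynomial.C (matrixEval Q (homogeneousComponent k p)) * Polynomial.X ^ k with hh
  have h0 : h = 0 := by
    refine Polynomial.funext fun t => ?_
    have h1 := hp (t • Q) ?_
    · rw [matrixEval] at h1
      have h2 := eval_smul_eq_sum p (fun ij : Fin M × Fin M => Q ij.1 ij.2) t
      simp only [Matrix.smul_apply, smul_eq_mul] at h1
      rw [h1] at h2
      simp [hh, Polynomial.eval_finsetSum, matrixEval, ← h2]
    · have : t • Q = (t • (1 : Matrix (Fin M) (Fin M) ℂ)) * Q := by simp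
      rw [this]
      exact (Matrix.rank_mul_le_right _ _).trans hQ
  by_cases hk : k < p.totalDegree + 1
  · have := congrArg (fun q => Polynomial.coeff q k) h0
    simpa [hh, Polynomial.finsetSum_coeff, Polynomial.coeff_C_mul, Polynomial.coeff_X_pow, hk]
      using this
  · rw [homogeneousComponent_eq_zero _ _ (by omega), map_zero]

theorem homogeneousComponent_succ_mul {σ : Type*} {l : MvPolynomial σ ℂ} (hl : l.IsHomogeneous 1)
    (g : MvPolynomial σ ℂ) (k : ℕ) :
    homogeneousComponent (k + 1) (g * l) = homogeneousComponent k g * l := by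
  conv_lhs => rw [← sum_homogeneousComponent g]
  rw [Finset.sum_mul, map_sum]
  have h : ∀ i, homogeneousComponent (k + 1) (homogeneousComponent i g * l) =
      if i = k then homogeneousComponent k g * l else 0 := by
    intro i
    rw [homogeneousComponent_of_mem (((homogeneousComponent_isHomogeneous i g).mul hl))]
    by_cases hi : i = k
    · simp [hi]
    · rw [if_neg (by omega), if_neg hi]
  simp only [h]
  rw [Finset.sum_ite_eq']
  split_ifs with hk
  · rfl
  · rw [homogeneousComponent_eq_zero, zero_mul]
    simpa using hk

theorem exists_homogeneous_decomposition {M N : ℕ} (y : EntryVar M N → ℂ) (T : Set (Fin N))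
    {k : ℕ} {u : MvPolynomial (Fin M × Fin M) ℂ} (hu : u.IsHomogeneous (k + 1))
    (hmem : u ∈ rankTwoIdeal M ⊔ Ideal.span (Set.range fun n : T => linForm y n)) :
    ∃ j ∈ rankTwoIdeal M, j.IsHomogeneous (k + 1) ∧
      ∃ g : T → MvPolynomial (Fin M × Fin M) ℂ, (∀ n, (g n).IsHomogeneous k) ∧
        u = j + ∑ᶠ n : T, g n * linForm y n := by
  classical
  have := Fintype.ofFinite T
  obtain ⟨j, hj, s, hs, rfl⟩ := Submodule.mem_sup.1 hmem
  obtain ⟨g, rfl⟩ := Ideal.mem_span_range_iff_exists_fun.1 hs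
  refine ⟨homogeneousComponent (k + 1) j, homogeneousComponent_mem_rankTwoIdeal hj _,
    homogeneousComponent_isHomogeneous _ _, fun n => homogeneousComponent k (g n),
    fun n => homogeneousComponent_isHomogeneous _ _, ?_⟩
  rw [finsum_eq_sum_of_fintype]
  conv_lhs => rw [← homogeneousComponent_eq_self hu]
  rw [map_add, map_sum]
  simp only [homogeneousComponent_succ_mul (isHomogeneous_linForm y _)]

theorem isHomogeneous_innerMonomial {M : ℕ} (e : Fin M × Fin M → ℕ) :
    (innerMonomial (fun i j : Fin M => (X (i, j) : MvPolynomial (Fin M × Fin M) ℂ)) e).IsHomogeneous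
      (∑ p : {p : Fin M × Fin M // 2 ≤ (p.1 : ℕ) ∧ 2 ≤ (p.2 : ℕ)}, e p.1) := by
  refine IsHomogeneous.prod _ _ _ fun p _ => ?_
  simpa using (isHomogeneous_X ℂ (p.1.1, p.1.2)).pow (e p.1)

theorem exists_reduced {M N : ℕ} {y : EntryVar M N → ℂ} (hy : DiagonalRelations (coordResidue y))
    (p : MvPolynomial (Fin M × Fin M) ℂ) :
    ∃ ρ ∈ reducedSpan (fun i j : Fin M => (X (i, j) : MvPolynomial (Fin M × Fin M) ℂ)),
      p - ρ ∈ rankTwoIdeal M ⊔ Ideal.span (Set.range (linForm y)) := by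
  set I := rankTwoIdeal M ⊔ Ideal.span (Set.range (linForm y))
  have h := hy.aeval_mem_reducedSpan p
  have h1 : aeval (fun ij : Fin M × Fin M => coordResidue y ij.1 ij.2) p =
      Ideal.Quotient.mkₐ ℂ I p := by
    have : aeval (fun ij : Fin M × Fin M => coordResidue y ij.1 ij.2) =
        Ideal.Quotient.mkₐ ℂ I := by
      refine MvPolynomial.algHom_ext fun ij => ?_
      simp [coordResidue, I]
    rw [this]
  have h2 : reducedSpan (coordResidue y) =
      (reducedSpan fun i j : Fin M => (X (i, j) : MvPolynomial (Fin M × Fin M) ℂ)).map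
        (Ideal.Quotient.mkₐ ℂ I).toLinearMap := by
    rw [reducedSpan, reducedSpan, Submodule.map_span, ← Set.image_comp]
    congr 1
    refine Set.image_congr fun e _ => ?_
    simp [innerMonomial, coordResidue, I]
  rw [h1, h2] at h
  obtain ⟨ρ, hρ, hρ2⟩ := h
  refine ⟨ρ, hρ, ?_⟩
  rw [← Ideal.Quotient.eq_zero_iff_mem, map_sub, sub_eq_zero]
  exact hρ2.symm

/-- Exponents at most two on the entries outside the first two rows and columns. -/
abbrev ReducedExponent (M : ℕ) : Type :=
  {p : Fin M × Fin M // 2 ≤ (p.1 : ℕ) ∧ 2 ≤ (p.2 : ℕ)} → Fin 3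

theorem card_innerEntries (M : ℕ) :
    Fintype.card {p : Fin M × Fin M // 2 ≤ (p.1 : ℕ) ∧ 2 ≤ (p.2 : ℕ)} = (M - 2) ^ 2 := by
  have h : ∀ n : ℕ, Fintype.card {i : Fin n // 2 ≤ (i : ℕ)} = n - 2 := by
    intro n
    rw [Fintype.card_subtype]
    rcases Nat.lt_or_ge n 2 with hn | hn
    · rw [Finset.card_eq_zero.2 (Finset.filter_eq_empty_iff.2 fun i _ => by omega)]
      omega
    · obtain ⟨m, rfl⟩ : ∃ m, n = m + 2 := ⟨n - 2, by omega⟩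
      have : (Finset.univ.filter fun i : Fin (m + 2) => 2 ≤ (i : ℕ)) =
          Finset.univ.map (Fin.natAddEmb 2 |>.trans (finCongr (add_comm 2 m)).toEmbedding) := by
        ext i
        simp only [Finset.mem_filter, Finset.mem_univ, true_and, Finset.mem_map]
        constructor
        · intro hi
          exact ⟨⟨(i : ℕ) - 2, by omega⟩, Fin.ext (by simp; omega)⟩
        · rintro ⟨a, rfl⟩
          simp
      rw [this, Finset.card_map, Finset.card_univ, Fintype.card_fin]
      rfl
  rw [Fintype.card_congr (Equiv.subtypeProdEquivProd (p := fun i : Fin M => 2 ≤ (i : ℕ))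
    (q := fun i : Fin M => 2 ≤ (i : ℕ))), Fintype.card_prod, h, sq]

theorem card_reducedExponent (M : ℕ) : Fintype.card (ReducedExponent M) = 3 ^ ((M - 2) ^ 2) := by
  rw [Fintype.card_fun, Fintype.card_fin, card_innerEntries]

/-- The exponent vector extended by zero. -/
def ReducedExponent.extend {M : ℕ} (e : ReducedExponent M) (p : Fin M × Fin M) : ℕ :=
  if h : 2 ≤ (p.1 : ℕ) ∧ 2 ≤ (p.2 : ℕ) then e ⟨p, h⟩ else 0

/-- The degree of a reduced monomial. -/
def ReducedExponent.degree {M : ℕ} (e : ReducedExponent M) : ℕ := ∑ p, (e p : ℕ)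

/-- The reduced monomial with a given exponent. -/
noncomputable def ReducedExponent.monomial {M : ℕ} (e : ReducedExponent M) :
    MvPolynomial (Fin M × Fin M) ℂ :=
  innerMonomial (fun i j : Fin M => X (i, j)) e.extend

theorem ReducedExponent.isHomogeneous_monomial {M : ℕ} (e : ReducedExponent M) :
    e.monomial.IsHomogeneous e.degree := by
  have h := isHomogeneous_innerMonomial e.extend
  have hd : e.degree = ∑ p : {p : Fin M × Fin M // 2 ≤ (p.1 : ℕ) ∧ 2 ≤ (p.2 : ℕ)},
      e.extend p.1 :=
    Finset.sum_congr rfl fun p _ => by rw [ReducedExponent.extend, dif_pos p.2]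
  rw [hd]
  exact h

theorem ReducedExponent.degree_le {M : ℕ} (e : ReducedExponent M) :
    e.degree ≤ 2 * (M * M) := by
  unfold ReducedExponent.degree
  refine (Finset.sum_le_card_nsmul Finset.univ (fun p => ((e p : Fin 3) : ℕ)) 2
    fun p _ => by have := (e p).2; omega).trans ?_
  rw [smul_eq_mul, mul_comm]
  refine Nat.mul_le_mul_left 2 ?_
  rw [Finset.card_univ]
  refine (Fintype.card_subtype_le _).trans ?_
  simp

theorem reducedSpan_eq (M : ℕ) :
    reducedSpan (fun i j : Fin M => (X (i, j) : MvPolynomial (Fin M × Fin M) ℂ)) =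
      Submodule.span ℂ (Set.range ReducedExponent.monomial) := by
  apply le_antisymm
  · refine Submodule.span_mono ?_
    rintro _ ⟨e, he, rfl⟩
    refine ⟨fun p => ⟨e p.1, by have := he p.1; omega⟩, ?_⟩
    refine Finset.prod_congr rfl fun p _ => ?_
    rw [ReducedExponent.extend, dif_pos p.2]
  · refine Submodule.span_mono ?_
    rintro _ ⟨e, rfl⟩
    refine ⟨e.extend, fun p => ?_, rfl⟩
    rw [ReducedExponent.extend]
    split_ifs with h
    · have := (e ⟨p, h⟩).2
      omega
    · omega

theorem homogeneousComponent_mem_span_reduced {M : ℕ} {ρ : MvPolynomial (Fin M × Fin M) ℂ}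
    (hρ : ρ ∈ reducedSpan (fun i j : Fin M => (X (i, j) : MvPolynomial (Fin M × Fin M) ℂ)))
    (k : ℕ) : homogeneousComponent k ρ ∈
      Submodule.span ℂ (ReducedExponent.monomial '' {e : ReducedExponent M | e.degree = k}) := by
  rw [reducedSpan_eq] at hρ
  have : Submodule.span ℂ (Set.range (ReducedExponent.monomial (M := M))) ≤
      (Submodule.span ℂ (ReducedExponent.monomial ''
        {e : ReducedExponent M | e.degree = k})).comap (homogeneousComponent k) := by
    rw [Submodule.span_le]
    rintro _ ⟨e, rfl⟩
    rw [SetLike.mem_coe, Submodule.mem_comap]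
    rw [homogeneousComponent_of_mem e.isHomogeneous_monomial]
    split_ifs with h
    · exact Submodule.subset_span ⟨e, h.symm, rfl⟩
    · exact Submodule.zero_mem _
  exact this hρ

theorem homogeneousComponent_mem_sup {M N : ℕ} (y : EntryVar M N → ℂ)
    {u : MvPolynomial (Fin M × Fin M) ℂ}
    (hu : u ∈ rankTwoIdeal M ⊔ Ideal.span (Set.range (linForm y))) (k : ℕ) :
    homogeneousComponent k u ∈ rankTwoIdeal M ⊔ Ideal.span (Set.range (linForm y)) := by
  obtain ⟨j, hj, s, hs, rfl⟩ := Submodule.mem_sup.1 hu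
  rw [map_add]
  refine Submodule.add_mem _ (Ideal.mem_sup_left (homogeneousComponent_mem_rankTwoIdeal hj k))
    (Ideal.mem_sup_right ?_)
  obtain ⟨g, rfl⟩ := Ideal.mem_span_range_iff_exists_fun.1 hs
  rw [map_sum]
  refine Ideal.sum_mem _ fun n _ => ?_
  cases k with
  | zero =>
    have h0 : homogeneousComponent 0 (g n * linForm y n) = 0 := by
      rw [homogeneousComponent_zero, ← constantCoeff_eq, map_mul, constantCoeff_eq,
        (isHomogeneous_linForm y n).coeff_eq_zero (by simp), mul_zero, C_0]
    rw [h0]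
    exact Ideal.zero_mem _
  | succ k =>
    rw [homogeneousComponent_succ_mul (isHomogeneous_linForm y n)]
    exact Ideal.mul_mem_left _ _ (Ideal.subset_span ⟨n, rfl⟩)

/-- The reduced monomials raised to degree `k` by powers of a linear form. -/
noncomputable def raisedMonomial {M N : ℕ} (y : EntryVar M N → ℂ) (n₀ : Fin N) (k : ℕ)
    (e : ReducedExponent M) : MvPolynomial (Fin M × Fin M) ℂ :=
  if e.degree ≤ k then linForm y n₀ ^ (k - e.degree) * e.monomial else 0

theorem isHomogeneous_raisedMonomial {M N : ℕ} (y : EntryVar M N → ℂ) (n₀ : Fin N) (k : ℕ)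
    (e : ReducedExponent M) : (raisedMonomial y n₀ k e).IsHomogeneous k := by
  unfold raisedMonomial
  split_ifs with h
  · have := ((isHomogeneous_linForm y n₀).pow (k - e.degree)).mul e.isHomogeneous_monomial
    rwa [one_mul, Nat.sub_add_cancel h] at this
  · exact isHomogeneous_zero _ _ _

/-- Dropping form `n₀` from the ideal costs at most one dimension per reduced monomial in each
degree. Modulo the remaining forms, `p` is a reduced part plus a multiple of form `n₀`. The cofactor
has lower degree, so induction applies, and multiplying by the form again takes raised monomials to
raised monomials. -/
theorem mem_sup_span_raisedMonomial {M N : ℕ} {y : EntryVar M N → ℂ}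
    (hy : DiagonalRelations (coordResidue y)) (n₀ : Fin N) (k : ℕ)
    {p : MvPolynomial (Fin M × Fin M) ℂ} (hp : p.IsHomogeneous k) :
    p ∈ (rankTwoIdeal M ⊔
        Ideal.span (Set.range fun n : {n | n ≠ n₀} => linForm y n)).restrictScalars ℂ ⊔
      Submodule.span ℂ (Set.range (raisedMonomial y n₀ k)) := by
  set U := rankTwoIdeal M ⊔ Ideal.span (Set.range fun n : {n | n ≠ n₀} => linForm y n) with hUdef
  have hU : ∀ (k : ℕ), ∀ q ∈ U, q ∈ U.restrictScalars ℂ ⊔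
      Submodule.span ℂ (Set.range (raisedMonomial y n₀ k)) := fun k q hq =>
    Submodule.mem_sup_left (show q ∈ U.restrictScalars ℂ from hq)
  induction k generalizing p with
  | zero =>
    refine Submodule.mem_sup_right ?_
    have h1 : raisedMonomial y n₀ 0 (0 : ReducedExponent M) = 1 := by
      simp [raisedMonomial, ReducedExponent.degree, ReducedExponent.monomial, innerMonomial,
        ReducedExponent.extend]
    rw [← homogeneousComponent_eq_self hp, homogeneousComponent_zero, ← mul_one (C _),
      ← smul_eq_C_mul, ← h1]
    exact Submodule.smul_mem _ _ (Submodule.subset_span ⟨0, rfl⟩)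
  | succ k ih =>
    obtain ⟨ρ, hρ, hpρ⟩ := exists_reduced hy p
    have hc := homogeneousComponent_mem_sup y hpρ (k + 1)
    have hr := homogeneousComponent_mem_span_reduced hρ (k + 1)
    rw [map_sub, homogeneousComponent_eq_self hp] at hc
    set r := homogeneousComponent (k + 1) ρ with hrdef
    have hrh : r.IsHomogeneous (k + 1) := homogeneousComponent_isHomogeneous _ _
    have huniv : (Set.range fun n : (Set.univ : Set (Fin N)) => linForm y n) =
        Set.range (linForm y) := by
      ext; simp
    rw [← huniv] at hc
    obtain ⟨j, hj, -, g, hg, hdec⟩ := exists_homogeneous_decomposition y Set.univ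
      (hp.sub hrh) hc
    rw [sub_eq_iff_eq_add] at hdec
    rw [hdec, finsum_eq_sum_of_fintype]
    refine Submodule.add_mem _ (Submodule.add_mem _ (hU _ _
      (Ideal.mem_sup_left hj)) (Submodule.sum_mem _ fun n _ => ?_)) (Submodule.mem_sup_right ?_)
    · by_cases hn : (n : Fin N) = n₀
      · obtain ⟨u, hu, f, hf, huf⟩ := Submodule.mem_sup.1 (ih (hg n))
        rw [← huf, add_mul, hn]
        refine Submodule.add_mem _ (hU _ _ (Ideal.mul_mem_right _ U hu))
          (Submodule.mem_sup_right ?_)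
        have : Submodule.span ℂ (Set.range (raisedMonomial y n₀ k)) ≤
            (Submodule.span ℂ (Set.range (raisedMonomial y n₀ (k + 1)))).comap
              (LinearMap.mulRight ℂ (linForm y n₀)) := by
          rw [Submodule.span_le]
          rintro _ ⟨e, rfl⟩
          rw [SetLike.mem_coe, Submodule.mem_comap, LinearMap.mulRight_apply]
          by_cases he : e.degree ≤ k
          · refine Submodule.subset_span ⟨e, ?_⟩
            rw [raisedMonomial, raisedMonomial, if_pos he, if_pos (he.trans k.le_succ),
              Nat.succ_sub he, pow_succ]
            ring
          · rw [raisedMonomial, if_neg he, zero_mul]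
            exact Submodule.zero_mem _
        exact this hf
      · exact hU _ _ (Ideal.mul_mem_left _ _
          (Ideal.mem_sup_right (Ideal.subset_span ⟨⟨n, hn⟩, rfl⟩)))
    · refine Submodule.span_mono ?_ hr
      rintro _ ⟨e, he, rfl⟩
      refine ⟨e, ?_⟩
      have he' : e.degree = k + 1 := he
      rw [raisedMonomial, if_pos he'.le, he', Nat.sub_self, pow_zero, one_mul]

theorem mem_sup_of_lt_degree {M N : ℕ} {y : EntryVar M N → ℂ}
    (hy : DiagonalRelations (coordResidue y)) {k : ℕ} (hk : 2 * (M * M) < k)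
    {p : MvPolynomial (Fin M × Fin M) ℂ} (hp : p.IsHomogeneous k) :
    p ∈ rankTwoIdeal M ⊔ Ideal.span (Set.range (linForm y)) := by
  obtain ⟨ρ, hρ, hpρ⟩ := exists_reduced hy p
  have hc := homogeneousComponent_mem_sup y hpρ k
  have hr := homogeneousComponent_mem_span_reduced hρ k
  have hempty : {e : ReducedExponent M | e.degree = k} = ∅ := by
    ext e
    have := e.degree_le
    simp only [Set.mem_ofPred_eq, Set.mem_empty_iff_false, iff_false]
    omega
  rw [hempty, Set.image_empty, Submodule.span_empty, Submodule.mem_bot] at hr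
  rwa [map_sub, homogeneousComponent_eq_self hp, hr, sub_zero] at hc

end PhaseRetrieval

/-! ### Macaulay determinants with controlled degree in one column -/

namespace PhaseRetrieval

open MvPolynomial

/-- A maximal independent subfamily indexed inside `s` is extended to a basis of `V`. The
codimension hypothesis bounds the number of added vectors. -/
theorem exists_linearIndependent_card_compl_le {K V ι : Type*} [Field K] [AddCommGroup V]
    [Module K V] [FiniteDimensional K V] (v : ι → V) (hv : ⊤ ≤ Submodule.span K (Set.range v))
    (s : Set ι) {D : ℕ}
    (hs : Module.finrank K V ≤ Module.finrank K (Submodule.span K (v '' s)) + D) :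
    ∃ σ : Fin (Module.finrank K V) → ι, LinearIndependent K (v ∘ σ) ∧
      {β | σ β ∉ s}.ncard ≤ D := by
  obtain ⟨b₀, hb₀s, -, hspan₀, hind₀⟩ :=
    exists_linearIndepOn_extension (linearIndepOn_empty K v) (Set.empty_subset s)
  obtain ⟨b, -, hb₀b, hspan, hind⟩ :=
    exists_linearIndepOn_extension hind₀ (Set.subset_univ b₀)
  have hcard : ∀ t : Set ι, LinearIndepOn K v t →
      t.Finite ∧ t.ncard = Module.finrank K (Submodule.span K (v '' t)) := by
    intro t ht
    have hfin : Finite t := LinearIndependent.finite ht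
    have := Fintype.ofFinite t
    refine ⟨t.toFinite, ?_⟩
    have h := finrank_span_eq_card (R := K) ht
    rw [← Nat.card_coe_set_eq, Nat.card_eq_fintype_card, ← h, Set.image_eq_range]
  have htop : Submodule.span K (v '' b) = ⊤ := by
    rw [eq_top_iff]
    refine hv.trans ?_
    rw [← Set.image_univ]
    exact Submodule.span_le.2 hspan
  have hle : Submodule.span K (v '' s) ≤ Submodule.span K (v '' b₀) := Submodule.span_le.2 hspan₀
  have hbcard := (hcard b hind).2
  rw [htop, finrank_top] at hbcard
  have hb₀card := (hcard b₀ hind₀).2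
  have hbfin := (hcard b hind).1
  have := hbfin.fintype
  have hbc : Fintype.card b = Module.finrank K V := by
    rw [← hbcard, ← Nat.card_coe_set_eq, Nat.card_eq_fintype_card]
  let e := (Fintype.equivFinOfCardEq hbc).symm
  refine ⟨fun β => (e β : ι), LinearIndependent.comp hind e e.injective, ?_⟩
  have himg : {β | (e β : ι) ∉ s}.ncard ≤ (b \ b₀).ncard := by
    refine Set.ncard_le_ncard_of_injOn (fun β => (e β : ι)) ?_ ?_ hbfin.sdiff
    · intro β hβ
      exact ⟨(e β).2, fun h => hβ (hb₀s h)⟩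
    · intro β _ γ _ h
      exact e.injective (Subtype.ext h)
  have hdiff := Set.ncard_sdiff_add_ncard_of_subset hb₀b hbfin
  have hmono := Submodule.finrank_mono hle
  change {β | (e β : ι) ∉ s}.ncard ≤ D
  omega

/-- Some nonzero matrix of rank at most two is annihilated by all the linear forms of `y`. -/
def HasLowRankSolution {M N : ℕ} (y : EntryVar M N → ℂ) : Prop :=
  ∃ Q : Matrix (Fin M) (Fin M) ℂ, Q ≠ 0 ∧ Q.rank ≤ 2 ∧ ∀ n, matrixEval Q (linForm y n) = 0

/-- The indices of the spanning family of the forms of degree `k + 1`. -/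
abbrev GeneratorIndex (M N k : ℕ) : Type :=
  {p : MvPolynomial (Fin M × Fin M) ℂ // p ∈ rankTwoIdeal M ∧ p.IsHomogeneous (k + 1)} ⊕
    (Fin N × {p : MvPolynomial (Fin M × Fin M) ℂ // p.IsHomogeneous k})

/-- The elements of the ideal generated by `rankTwoIdeal` and the linear forms. -/
noncomputable def generator {M N : ℕ} (k : ℕ) (y : EntryVar M N → ℂ) :
    GeneratorIndex M N k → homogeneousSubmodule (Fin M × Fin M) ℂ (k + 1)
  | Sum.inl p => ⟨p.1, p.2.2⟩
  | Sum.inr (n, g) => ⟨g.1 * linForm y n, g.2.mul (isHomogeneous_linForm y n)⟩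

theorem generator_inr {M N : ℕ} (k : ℕ) (y : EntryVar M N → ℂ) (n : Fin N)
    (g : {p : MvPolynomial (Fin M × Fin M) ℂ // p.IsHomogeneous k}) :
    generator k y (Sum.inr (n, g)) = ∑ i, ∑ j, (y (Sum.inr (i, n)) * y (Sum.inl (j, n))) •
      (⟨g.1 * X (i, j), g.2.mul (isHomogeneous_X ℂ (i, j))⟩ :
        homogeneousSubmodule (Fin M × Fin M) ℂ (k + 1)) := by
  apply Subtype.ext
  simp only [generator, AddSubmonoidClass.coe_finsetSum, Submodule.coe_smul, linForm,
    Finset.mul_sum, smul_eq_C_mul]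
  refine Finset.sum_congr rfl fun i _ => Finset.sum_congr rfl fun j _ => ?_
  ring

instance (M k : ℕ) : FiniteDimensional ℂ (homogeneousSubmodule (Fin M × Fin M) ℂ k) :=
  Module.Finite.iff_fg.2 (weightedHomogeneousSubmodule_fg ℂ _ (fun _ => one_ne_zero) k)

/-- The index set allows all elements of the rank ideal but only the multiples of forms indexed by
`T`, so membership in the graded ideal becomes linear algebra. -/
theorem mem_span_generator {M N : ℕ} (y : EntryVar M N → ℂ) (T : Set (Fin N)) {k : ℕ}
    (u : homogeneousSubmodule (Fin M × Fin M) ℂ (k + 1))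
    (hmem : (u : MvPolynomial (Fin M × Fin M) ℂ) ∈
      rankTwoIdeal M ⊔ Ideal.span (Set.range fun n : T => linForm y n)) :
    u ∈ Submodule.span ℂ (generator k y '' {i | ∀ n g, i = Sum.inr (n, g) → n ∈ T}) := by
  classical
  obtain ⟨j, hj, hjh, g, hg, hu⟩ := exists_homogeneous_decomposition y T u.2 hmem
  have := Fintype.ofFinite T
  rw [finsum_eq_sum_of_fintype] at hu
  have hu' : u = generator k y (Sum.inl ⟨j, hj, hjh⟩) +
      ∑ n : T, generator k y (Sum.inr (n, ⟨g n, hg n⟩)) := by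
    apply Subtype.ext
    rw [hu]
    simp [generator]
  rw [hu']
  refine Submodule.add_mem _ (Submodule.subset_span ⟨_, ?_, rfl⟩)
    (Submodule.sum_mem _ fun n _ => Submodule.subset_span ⟨_, ?_, rfl⟩)
  · intro _ _ h
    cases h
  · intro m g' h
    have := congrArg Prod.fst (Sum.inr_injective h)
    change (n : Fin N) = m at this
    rw [← this]
    exact n.2

theorem span_generator_eq_top {M N : ℕ} {y : EntryVar M N → ℂ}
    (hy : DiagonalRelations (coordResidue y)) :
    ⊤ ≤ Submodule.span ℂ (Set.range (generator (2 * (M * M)) y)) := by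
  intro u _
  have huniv : (Set.range fun n : (Set.univ : Set (Fin N)) => linForm y n) =
      Set.range (linForm y) := by
    ext; simp
  have h := mem_span_generator y Set.univ u (by
    rw [huniv]
    exact mem_sup_of_lt_degree hy (Nat.lt_succ_self _) u.2)
  exact Submodule.span_mono (Set.image_subset_range _ _) h

theorem finrank_le_finrank_span_generator {M N : ℕ} {y : EntryVar M N → ℂ}
    (hy : DiagonalRelations (coordResidue y)) (n₀ : Fin N) (k : ℕ) :
    Module.finrank ℂ (homogeneousSubmodule (Fin M × Fin M) ℂ (k + 1)) ≤
      Module.finrank ℂ (Submodule.span ℂ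
        (generator k y '' {i | ∀ n g, i = Sum.inr (n, g) → n ∈ {n | n ≠ n₀}})) +
        3 ^ ((M - 2) ^ 2) := by
  set r : ReducedExponent M → homogeneousSubmodule (Fin M × Fin M) ℂ (k + 1) :=
    fun e => ⟨raisedMonomial y n₀ (k + 1) e, isHomogeneous_raisedMonomial y n₀ (k + 1) e⟩ with hr
  set S := Submodule.span ℂ
    (generator k y '' {i | ∀ n g, i = Sum.inr (n, g) → n ∈ {n | n ≠ n₀}}) with hS
  have htop : S ⊔ Submodule.span ℂ (Set.range r) = ⊤ := by
    rw [eq_top_iff]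
    intro p _
    obtain ⟨u, hu, f, hf, huf⟩ := Submodule.mem_sup.1
      (mem_sup_span_raisedMonomial hy n₀ (k + 1) p.2)
    have hmap : Submodule.span ℂ (Set.range (raisedMonomial y n₀ (k + 1))) =
        (Submodule.span ℂ (Set.range r)).map (Submodule.subtype _) := by
      rw [Submodule.map_span, ← Set.range_comp]
      rfl
    rw [hmap] at hf
    obtain ⟨f', hf', rfl⟩ := hf
    have hp : p = (p - f') + f' := by abel
    rw [hp]
    refine Submodule.add_mem_sup (mem_span_generator y _ (p - f') ?_) hf'
    have : ((p - f' : homogeneousSubmodule (Fin M × Fin M) ℂ (k + 1)) :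
        MvPolynomial (Fin M × Fin M) ℂ) = u := by
      rw [AddSubgroupClass.coe_sub, ← huf]
      simp
    rw [this]
    exact hu
  have h1 := Submodule.finrank_add_le_finrank_add_finrank S (Submodule.span ℂ (Set.range r))
  rw [htop, finrank_top] at h1
  have h2 : Module.finrank ℂ (Submodule.span ℂ (Set.range r)) ≤ 3 ^ ((M - 2) ^ 2) := by
    rw [← card_reducedExponent]
    exact finrank_range_le_card r
  omega

/-- The coordinates of a generator as polynomials in the entries of the frame pair. -/
noncomputable def generatorCoord {M N : ℕ} (k : ℕ)
    (α : Fin (Module.finrank ℂ (homogeneousSubmodule (Fin M × Fin M) ℂ (k + 1)))) :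
    GeneratorIndex M N k → MvPolynomial (EntryVar M N) ℂ
  | Sum.inl p => C ((Module.finBasis ℂ _).repr
      (⟨p.1, p.2.2⟩ : homogeneousSubmodule (Fin M × Fin M) ℂ (k + 1)) α)
  | Sum.inr (n, g) => ∑ i, ∑ j, C ((Module.finBasis ℂ _).repr
      (⟨g.1 * X (i, j), g.2.mul (isHomogeneous_X ℂ (i, j))⟩ :
        homogeneousSubmodule (Fin M × Fin M) ℂ (k + 1)) α) *
        (X (Sum.inr (i, n)) * X (Sum.inl (j, n)))

theorem eval_generatorCoord {M N : ℕ} (k : ℕ)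
    (α : Fin (Module.finrank ℂ (homogeneousSubmodule (Fin M × Fin M) ℂ (k + 1))))
    (i : GeneratorIndex M N k) (y : EntryVar M N → ℂ) :
    eval y (generatorCoord k α i) = (Module.finBasis ℂ _).repr (generator k y i) α := by
  rcases i with p | ⟨n, g⟩
  · simp [generatorCoord, generator]
  · rw [generator_inr]
    simp only [generatorCoord, map_sum, map_mul, eval_C, eval_X, map_smul, Finsupp.coe_finsetSum,
      Finset.sum_apply, Finsupp.smul_apply, smul_eq_mul]
    refine Finset.sum_congr rfl fun i _ => Finset.sum_congr rfl fun j _ => ?_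
    ring

theorem isWeightedHomogeneous_generatorCoord {M N : ℕ} (k : ℕ)
    (α : Fin (Module.finrank ℂ (homogeneousSubmodule (Fin M × Fin M) ℂ (k + 1))))
    (i : GeneratorIndex M N k) (n₀ : Fin N) [Decidable (∀ n g, i = Sum.inr (n, g) → n ≠ n₀)] :
    IsWeightedHomogeneous (columnWeight (M := M) n₀) (generatorCoord k α i)
      (if ∀ n g, i = Sum.inr (n, g) → n ≠ n₀ then 0 else 2) := by
  rcases i with p | ⟨n, g⟩
  · rw [if_pos (by intro _ _ h; cases h)]
    exact isWeightedHomogeneous_C _ _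
  · refine IsWeightedHomogeneous.sum _ _ _ fun i _ => IsWeightedHomogeneous.sum _ _ _ fun j _ => ?_
    have h := (isWeightedHomogeneous_C (columnWeight (M := M) n₀) ((Module.finBasis ℂ _).repr
      (⟨g.1 * X (i, j), g.2.mul (isHomogeneous_X ℂ (i, j))⟩ :
        homogeneousSubmodule (Fin M × Fin M) ℂ (k + 1)) α)).mul
      ((isWeightedHomogeneous_X ℂ (columnWeight (M := M) n₀) (Sum.inr (i, n))).mul
        (isWeightedHomogeneous_X ℂ (columnWeight (M := M) n₀) (Sum.inl (j, n))))
    convert h using 1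
    by_cases hn : n = n₀
    · rw [if_neg (fun h => h n g rfl hn)]
      simp [columnWeight, hn]
    · rw [if_pos]
      · simp [columnWeight, hn]
      · intro m g' h
        have := congrArg Prod.fst (Sum.inr_injective h)
        change n = m at this
        rwa [← this]

/-- At the special frame the generators span all forms of degree `k + 1`, and a basis can be chosen
with at most $3^{(M-2)^2}$ multiples of form `n₀`. The same choice of generators at a variable frame
has a coordinate determinant, and only those multiples contribute to its degree in column `n₀`, two
each. -/
theorem exists_columnDegree_le {M : ℕ} (hM : 2 ≤ M) (n₀ : Fin (4 * M - 4)) :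
    ∃ Δ : MvPolynomial (EntryVar M (4 * M - 4)) ℂ, Δ ≠ 0 ∧
      (∀ y, HasLowRankSolution y → eval y Δ = 0) ∧
      ∃ d ≤ 2 * 3 ^ ((M - 2) ^ 2), IsWeightedHomogeneous (columnWeight (M := M) n₀) Δ d := by
  classical
  obtain ⟨y₀, hy₀⟩ := exists_diagonalRelations hM
  -- Reduced monomials have degree at most this `k`, so all forms of degree `k + 1` lie in the ideal
  -- at the special frame.
  set k := 2 * (M * M)
  set s : Set (GeneratorIndex M (4 * M - 4) k) :=
    {i | ∀ n g, i = Sum.inr (n, g) → n ∈ {n | n ≠ n₀}} with hs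
  obtain ⟨σ, hσ, hcard⟩ := exists_linearIndependent_card_compl_le (generator k y₀)
    (span_generator_eq_top hy₀) s (finrank_le_finrank_span_generator hy₀ n₀ k)
  set B := Module.finBasis ℂ (homogeneousSubmodule (Fin M × Fin M) ℂ (k + 1)) with hB
  have heval : ∀ y, eval y (Matrix.of fun α β => generatorCoord k α (σ β)).det =
      B.det (generator k y ∘ σ) := by
    intro y
    rw [RingHom.map_det, Module.Basis.det_apply]
    congr 1
    ext α β
    simp [eval_generatorCoord, Module.Basis.toMatrix_apply, hB]
  refine ⟨(Matrix.of fun α β => generatorCoord k α (σ β)).det, ?_, ?_, ?_⟩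
  · intro h0
    have h1 := heval y₀
    rw [h0, map_zero] at h1
    have h2 := (Module.Basis.is_basis_iff_det B (v := generator k y₀ ∘ σ)).1
      ⟨hσ, hσ.span_eq_top_of_card_eq_finrank' (by simp)⟩
    exact h2.ne_zero h1.symm
  · rintro y ⟨Q, hQ0, hQ2, hQ⟩
    rw [heval]
    by_contra hne
    have hspan := ((Module.Basis.is_basis_iff_det B (v := generator k y ∘ σ)).2 (Ne.isUnit hne)).2
    obtain ⟨i, j, hij⟩ : ∃ i j, Q i j ≠ 0 := by
      by_contra h
      push Not at h
      exact hQ0 (by ext i j; exact h i j)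
    let ev : homogeneousSubmodule (Fin M × Fin M) ℂ (k + 1) →ₗ[ℂ] ℂ :=
      (aeval (R := ℂ) fun p : Fin M × Fin M => Q p.1 p.2).toLinearMap ∘ₗ Submodule.subtype _
    have hev : ∀ p, ev p = matrixEval Q p := fun p => by
      simp [ev, matrixEval, aeval_eq_eval]
    -- Evaluation at a common zero `Q` kills every generator. If these formed a basis it would kill
    -- all forms of degree `k + 1`, yet a power of a coordinate with `Q i j ≠ 0` survives.
    have hker : Submodule.span ℂ (Set.range (generator k y ∘ σ)) ≤ LinearMap.ker ev := by
      rw [Submodule.span_le]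
      rintro _ ⟨β, rfl⟩
      rw [SetLike.mem_coe, LinearMap.mem_ker, hev, Function.comp_apply]
      rcases σ β with p | ⟨n, g⟩
      · exact mem_rankTwoIdeal.1 p.2.1 Q hQ2
      · simp [generator, hQ n]
    rw [hspan] at hker
    have hX : (X (i, j) ^ (k + 1) : MvPolynomial (Fin M × Fin M) ℂ).IsHomogeneous (k + 1) := by
      simpa using (isHomogeneous_X ℂ (i, j)).pow (k + 1)
    have := hker (Submodule.mem_top (x := ⟨_, hX⟩))
    rw [LinearMap.mem_ker, hev] at this
    simp [matrixEval] at this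
    exact hij this
  · refine ⟨∑ β, if ∀ n g, σ β = Sum.inr (n, g) → n ≠ n₀ then 0 else 2, ?_, ?_⟩
    · have hset : {β | σ β ∉ s} = ↑(Finset.univ.filter fun β =>
          ¬ ∀ n g, σ β = Sum.inr (n, g) → n ≠ n₀) := by
        ext β
        simp [hs]
      rw [hset, Set.ncard_coe_finset] at hcard
      rw [Finset.sum_ite, Finset.sum_const_zero, zero_add, Finset.sum_const, smul_eq_mul, mul_comm]
      exact Nat.mul_le_mul_left 2 hcard
    · rw [Matrix.det_apply]
      refine IsWeightedHomogeneous.sum _ _ _ fun τ _ => ?_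
      have hprod : IsWeightedHomogeneous (columnWeight (M := M) n₀)
          (∏ β, (Matrix.of fun α β => generatorCoord k α (σ β)) (τ β) β)
          (∑ β, if ∀ n g, σ β = Sum.inr (n, g) → n ≠ n₀ then 0 else 2) :=
        IsWeightedHomogeneous.prod _ _ _ fun β _ =>
          isWeightedHomogeneous_generatorCoord k (τ β) (σ β) n₀
      rcases Int.units_eq_one_or (Equiv.Perm.sign τ) with h | h
      · rw [h, one_smul]
        exact hprod
      · rw [h, Units.neg_smul, one_smul]
        exact hprod.neg

end PhaseRetrieval

/-! ### Prime ideals that meet the coefficient ring trivially are principal -/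

namespace PhaseRetrieval

/-- Some prime factor `F` of an element of least degree lies in `I`. Pseudo-division gives `F`
dividing the product of its leading coefficient with `G`. As `F` has positive degree, it does not
divide that nonzero constant, so it divides `G`. -/
theorem exists_generator_of_isPrime {A : Type*} [CommRing A] [IsDomain A]
    [UniqueFactorizationMonoid A] (I : Ideal (Polynomial A)) [hI : I.IsPrime] (hne : I ≠ ⊥)
    (hC : ∀ a, Polynomial.C a ∈ I → a = 0) :
    ∃ F ∈ I, F ≠ 0 ∧ ∀ G ∈ I, F ∣ G := by
  classical
  have hex : ∃ n, ∃ F ∈ I, F ≠ 0 ∧ F.natDegree = n := by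
    obtain ⟨F, hF, hF0⟩ := Submodule.exists_mem_ne_zero_of_ne_bot hne
    exact ⟨_, F, hF, hF0, rfl⟩
  obtain ⟨F₀, hF₀, hF₀0, hdeg₀⟩ := Nat.find_spec hex
  have hmin : ∀ G ∈ I, G ≠ 0 → F₀.natDegree ≤ G.natDegree := fun G hG hG0 => by
    rw [hdeg₀]
    exact Nat.find_min' hex ⟨G, hG, hG0, rfl⟩
  obtain ⟨f, hf, hassoc⟩ := UniqueFactorizationMonoid.exists_prime_factors F₀ hF₀0
  have hprod : f.prod ∈ I := by
    obtain ⟨u, hu⟩ := hassoc.symm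
    rw [← hu]
    exact I.mul_mem_right _ hF₀
  obtain ⟨F, hFf, hFI⟩ := (hI.multiset_prod_mem_iff_exists_mem f).1 hprod
  have hFp := hf F hFf
  have hdvd : F ∣ F₀ := (Multiset.dvd_prod hFf).trans hassoc.dvd
  have hFmin : ∀ G ∈ I, G ≠ 0 → F.natDegree ≤ G.natDegree := fun G hG hG0 =>
    (Polynomial.natDegree_le_of_dvd hdvd hF₀0).trans (hmin G hG hG0)
  refine ⟨F, hFI, hFp.ne_zero, fun G hG => ?_⟩
  have hpos : F.natDegree ≠ 0 := by
    intro h0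
    rw [Polynomial.eq_C_of_natDegree_eq_zero h0] at hFI
    have := hC _ hFI
    exact hFp.ne_zero (by rw [Polynomial.eq_C_of_natDegree_eq_zero h0, this, Polynomial.C_0])
  have hlc : ¬ F ∣ Polynomial.C F.leadingCoeff := by
    intro h
    have := Polynomial.natDegree_le_of_dvd h
      (Polynomial.C_ne_zero.2 (Polynomial.leadingCoeff_ne_zero.2 hFp.ne_zero))
    rw [Polynomial.natDegree_C] at this
    omega
  obtain ⟨n, hn⟩ : ∃ n, G.natDegree = n := ⟨_, rfl⟩
  induction n using Nat.strong_induction_on generalizing G with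
  | _ n ih =>
  by_cases hG0 : G = 0
  · rw [hG0]
    exact dvd_zero F
  have hle := hFmin G hG hG0
  set H := Polynomial.C F.leadingCoeff * G -
    Polynomial.C G.leadingCoeff * Polynomial.X ^ (G.natDegree - F.natDegree) * F with hH
  have hHI : H ∈ I := I.sub_mem (I.mul_mem_left _ hG) (I.mul_mem_left _ hFI)
  have hFH : F ∣ H := by
    by_cases hH0 : H = 0
    · rw [hH0]
      exact dvd_zero F
    refine ih H.natDegree ?_ H hHI rfl
    have h1 : H.natDegree ≤ G.natDegree := by
      refine (Polynomial.natDegree_sub_le _ _).trans (max_le ?_ ?_)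
      · exact Polynomial.natDegree_C_mul_le _ _
      · refine Polynomial.natDegree_mul_le.trans ?_
        have := Polynomial.natDegree_C_mul_X_pow_le G.leadingCoeff (G.natDegree - F.natDegree)
        omega
    have h2 : H.coeff G.natDegree = 0 := by
      rw [hH, Polynomial.coeff_sub, Polynomial.coeff_C_mul, mul_assoc, Polynomial.coeff_C_mul,
        Polynomial.coeff_X_pow_mul', if_pos (Nat.sub_le _ _), Nat.sub_sub_self hle,
        Polynomial.coeff_natDegree, Polynomial.coeff_natDegree]
      ring
    rw [← hn]
    refine lt_of_le_of_ne h1 fun h => hH0 ?_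
    rw [← h, Polynomial.coeff_natDegree] at h2
    exact Polynomial.leadingCoeff_eq_zero.1 h2
  have h3 : F ∣ Polynomial.C F.leadingCoeff * G := by
    have : Polynomial.C F.leadingCoeff * G = H +
        Polynomial.C G.leadingCoeff * Polynomial.X ^ (G.natDegree - F.natDegree) * F := by
      rw [hH]
      ring
    rw [this]
    exact dvd_add hFH (dvd_mul_left _ _)
  exact (hFp.dvd_or_dvd h3).resolve_left hlc

-- Reduction to one variable: the ring is viewed as polynomials in `x₀` over the other variables,
-- where `h` says that `I` contains no nonzero constant.
open MvPolynomial in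
theorem exists_generator_of_isPrime_mvPolynomial {σ K : Type*} [Field K]
    (I : Ideal (MvPolynomial σ K)) [hI : I.IsPrime] (hne : I ≠ ⊥) (x₀ : σ)
    (h : ∀ G : MvPolynomial {x // x ≠ x₀} K, rename Subtype.val G ∈ I → G = 0) :
    ∃ F ∈ I, F ≠ 0 ∧ ∀ G ∈ I, F ∣ G := by
  classical
  let e : MvPolynomial σ K ≃ₐ[K] Polynomial (MvPolynomial {x // x ≠ x₀} K) :=
    (renameEquiv K (Equiv.optionSubtypeNe x₀).symm).trans (optionEquivLeft K {x // x ≠ x₀})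
  let e' := e.symm.toRingEquiv
  have he : ∀ a, e.symm (Polynomial.C a) = rename Subtype.val a := by
    intro a
    rw [AlgEquiv.symm_apply_eq]
    induction a using MvPolynomial.induction_on with
    | C c => simp [e]
    | add p q hp hq => simp only [map_add, hp, hq]
    | mul_X p x hp =>
      simp only [map_mul, hp, rename_X]
      congr 1
      simp [e, optionEquivLeft_X_some, Equiv.optionSubtypeNe_symm_apply, x.2]
  have : (I.comap e').IsPrime := Ideal.comap_isPrime _ _
  obtain ⟨F, hF, hF0, hdvd⟩ := exists_generator_of_isPrime (I.comap e') (by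
      obtain ⟨F, hF, hF0⟩ := Submodule.exists_mem_ne_zero_of_ne_bot hne
      intro hbot
      have h1 : e F ∈ I.comap e' := by
        rw [Ideal.mem_comap]
        change e.symm (e F) ∈ I
        rwa [e.symm_apply_apply]
      rw [hbot, Ideal.mem_bot] at h1
      exact hF0 (by simpa using h1)) (fun a ha => h a (by
      rw [← he]
      exact ha))
  refine ⟨e.symm F, hF, by simpa using hF0, fun G hG => ?_⟩
  have h1 : e G ∈ I.comap e' := by
    rw [Ideal.mem_comap]
    change e.symm (e G) ∈ I
    rwa [e.symm_apply_apply]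
  have h2 := map_dvd e.symm (hdvd _ h1)
  rwa [e.symm_apply_apply] at h2

end PhaseRetrieval

/-! ### Irreducibility of the locus by a parametrization -/

namespace PhaseRetrieval

open MvPolynomial

/-- The column `aₙ` encoded by `y`. -/
def leftCol {A : Type*} {M N : ℕ} (y : EntryVar M N → A) (n : Fin N) (j : Fin M) : A :=
  y (Sum.inl (j, n))

/-- The column `bₙ` encoded by `y`. -/
def rightCol {A : Type*} {M N : ℕ} (y : EntryVar M N → A) (n : Fin N) (i : Fin M) : A :=
  y (Sum.inr (i, n))

/-- The point of the frame space with given columns. -/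
def ofCols {A : Type*} {M N : ℕ} (a b : Fin N → Fin M → A) : EntryVar M N → A :=
  Sum.elim (fun p => a p.2 p.1) (fun p => b p.2 p.1)

theorem ofCols_leftCol_rightCol {A : Type*} {M N : ℕ} (y : EntryVar M N → A) :
    ofCols (leftCol y) (rightCol y) = y := by
  ext p
  rcases p with p | p <;> rfl

theorem matrixEval_linForm_eq_dotProduct {M N : ℕ} (y : EntryVar M N → ℂ) (n : Fin N)
    (Q : Matrix (Fin M) (Fin M) ℂ) :
    matrixEval Q (linForm y n) = rightCol y n ⬝ᵥ Q.mulVec (leftCol y n) := by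
  rw [matrixEval_linForm]
  simp only [dotProduct, Matrix.mulVec, Finset.mul_sum, rightCol, leftCol]
  refine Finset.sum_congr rfl fun i _ => Finset.sum_congr rfl fun j _ => ?_
  ring

/-- Parameters of the incidence variety over matrices of rank two: two square matrices and, for each
`n`, two vectors. -/
abbrev ParamVar (M N : ℕ) : Type :=
  ((Fin M × Fin M) ⊕ (Fin M × Fin M)) ⊕ ((Fin N × Fin M) ⊕ (Fin N × Fin M))

variable {m N : ℕ}

/-- The first vector of the pair parametrizing the cone `α₀ β₀ + α₁ β₁ = 0`. -/
def coneLeft {A : Type*} [CommRing A] (c d : Fin (m + 2) → A) (i : Fin (m + 2)) : A :=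
  if i = 0 then d 0 * c 0 else if i = 1 then d 0 * c 1 else c i

/-- The second vector of the pair parametrizing the cone `α₀ β₀ + α₁ β₁ = 0`. -/
def coneRight {A : Type*} [CommRing A] (c d : Fin (m + 2) → A) (i : Fin (m + 2)) : A :=
  if i = 0 then -(d 1 * c 1) else if i = 1 then d 1 * c 0 else d i

/-- The parametrization of the incidence variety over matrices of rank two. -/
def paramPoint {A : Type*} [CommRing A] (q : ParamVar (m + 2) N → A) : EntryVar (m + 2) N → A :=
  ofCols
    (fun n j => ∑ i, q (Sum.inl (Sum.inl (j, i))) *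
      coneLeft (fun k => q (Sum.inr (Sum.inl (n, k)))) (fun k => q (Sum.inr (Sum.inr (n, k)))) i)
    (fun n j => ∑ i, q (Sum.inl (Sum.inr (j, i))) *
      coneRight (fun k => q (Sum.inr (Sum.inl (n, k)))) (fun k => q (Sum.inr (Sum.inr (n, k)))) i)

theorem map_paramPoint {A B : Type*} [CommRing A] [CommRing B] (f : A →+* B)
    (q : ParamVar (m + 2) N → A) (v : EntryVar (m + 2) N) :
    f (paramPoint q v) = paramPoint (fun w => f (q w)) v := by
  rcases v with ⟨j, n⟩ | ⟨j, n⟩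
  · simp only [paramPoint, ofCols, Sum.elim_inl, map_sum, map_mul, coneLeft, apply_ite f]
  · simp only [paramPoint, ofCols, Sum.elim_inr, map_sum, map_mul, coneRight, apply_ite f, map_neg]

/-- The ideal of the polynomials vanishing on the parametrized incidence variety. -/
noncomputable def paramIdeal (m N : ℕ) : Ideal (MvPolynomial (EntryVar (m + 2) N) ℂ) :=
  RingHom.ker (aeval (R := ℂ) (paramPoint (X (R := ℂ) : ParamVar (m + 2) N → _)))

instance : (paramIdeal m N).IsPrime := RingHom.ker_isPrime _

theorem eval_aeval_paramPoint (F : MvPolynomial (EntryVar (m + 2) N) ℂ)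
    (q : ParamVar (m + 2) N → ℂ) :
    eval q (aeval (R := ℂ) (paramPoint (X (R := ℂ) : ParamVar (m + 2) N → _)) F) =
      eval (paramPoint q) F := by
  have h : (eval q).comp (aeval (R := ℂ)
      (paramPoint (X (R := ℂ) : ParamVar (m + 2) N → _))).toRingHom = eval (paramPoint q) := by
    refine MvPolynomial.ringHom_ext (fun c => by simp) fun v => ?_
    simp [map_paramPoint]
  exact congrArg (fun f => f F) h

theorem eval_paramPoint_eq_zero {F : MvPolynomial (EntryVar (m + 2) N) ℂ}
    (hF : F ∈ paramIdeal m N) (q : ParamVar (m + 2) N → ℂ) : eval (paramPoint q) F = 0 := by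
  rw [← eval_aeval_paramPoint]
  have : aeval (R := ℂ) (paramPoint (X (R := ℂ) : ParamVar (m + 2) N → _)) F = 0 := hF
  rw [this, map_zero]

/-- Orthogonal vectors in the plane have the form $u(t,t')$ and $s(-t',t)$, so the quadric cone is a
polynomial image of affine space. -/
theorem exists_cone_param {r r' p p' : ℂ} (h : r * p + r' * p' = 0) :
    ∃ u s t t' : ℂ, u * t = r ∧ u * t' = r' ∧ -(s * t') = p ∧ s * t = p' := by
  by_cases hr : r = 0
  · by_cases hr' : r' = 0
    · exact ⟨0, 1, p', -p, by simp [hr], by simp [hr'], by simp, by simp⟩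
    · refine ⟨1, -p / r', r, r', by simp, by simp, by field_simp, ?_⟩
      rw [hr, zero_mul, zero_add] at h
      rw [hr, mul_zero, (mul_eq_zero.1 h).resolve_left hr']
  · refine ⟨1, p' / r, r, r', by simp, by simp, ?_, by field_simp⟩
    field_simp
    linear_combination -h

theorem eval_eq_zero_of_cone {F : MvPolynomial (EntryVar (m + 2) N) ℂ}
    (hF : F ∈ paramIdeal m N) (H G : Matrix (Fin (m + 2)) (Fin (m + 2)) ℂ)
    (α β : Fin N → Fin (m + 2) → ℂ) (h : ∀ n, α n 0 * β n 0 + α n 1 * β n 1 = 0) :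
    eval (ofCols (fun n => H.mulVec (α n)) (fun n => G.mulVec (β n))) F = 0 := by
  choose u s t t' h1 h2 h3 h4 using fun n => exists_cone_param (h n)
  have := eval_paramPoint_eq_zero hF (Sum.elim
    (Sum.elim (fun p => H p.1 p.2) (fun p => G p.1 p.2))
    (Sum.elim (fun p => if p.2 = 0 then t p.1 else if p.2 = 1 then t' p.1 else α p.1 p.2)
      (fun p => if p.2 = 0 then u p.1 else if p.2 = 1 then s p.1 else β p.1 p.2)))
  rw [← this]
  congr 2
  funext v
  rcases v with ⟨j, n⟩ | ⟨j, n⟩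
  · simp only [ofCols, paramPoint, Sum.elim_inl, Sum.elim_inr, Matrix.mulVec, dotProduct]
    refine Finset.sum_congr rfl fun i _ => ?_
    simp only [coneLeft]
    by_cases hi0 : i = 0
    · simp [hi0, h1]
    · by_cases hi1 : i = 1
      · simp [hi1, h2]
      · simp [hi0, hi1]
  · simp only [ofCols, paramPoint, Sum.elim_inl, Sum.elim_inr, Matrix.mulVec, dotProduct]
    refine Finset.sum_congr rfl fun i _ => ?_
    simp only [coneRight]
    by_cases hi0 : i = 0
    · simp [hi0, h3]
    · by_cases hi1 : i = 1
      · simp [hi1, h4]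
      · simp [hi0, hi1]

/-- The factor `δ` is absorbed by rescaling coordinate `1` of `α` and the matching column of `H`. -/
theorem eval_eq_zero_of_scaled_cone {F : MvPolynomial (EntryVar (m + 2) N) ℂ}
    (hF : F ∈ paramIdeal m N) (H G : Matrix (Fin (m + 2)) (Fin (m + 2)) ℂ)
    (α β : Fin N → Fin (m + 2) → ℂ) {δ : ℂ} (hδ : δ ≠ 0)
    (h : ∀ n, α n 0 * β n 0 + δ * (α n 1 * β n 1) = 0) :
    eval (ofCols (fun n => H.mulVec (α n)) (fun n => G.mulVec (β n))) F = 0 := by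
  set c : Fin (m + 2) → ℂ := fun i => if i = 1 then δ else 1 with hc
  have hc0 : ∀ i, c i ≠ 0 := by
    intro i
    simp only [hc]
    split_ifs <;> simp [hδ]
  have := eval_eq_zero_of_cone hF (Matrix.of fun j i => H j i * (c i)⁻¹) G
    (fun n i => c i * α n i) β (fun n => by
      simp only [hc, if_true]
      rw [if_neg (by simp)]
      linear_combination h n)
  rw [← this]
  congr 2
  funext v
  rcases v with ⟨j, n⟩ | ⟨j, n⟩
  · simp only [ofCols, Sum.elim_inl, Matrix.mulVec, dotProduct, Matrix.of_apply]
    refine Finset.sum_congr rfl fun i _ => ?_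
    have := hc0 i
    field_simp
  · rfl

/-- The parameter enters as $\varepsilon^2$ so that the singular case $a=b=0$ also has a continuous
solution, $f=\varepsilon$ and $g=-\varepsilon\gamma$. -/
theorem exists_curve {a b : ℂ} (γ : ℂ) (h : a * b = 0) :
    ∃ f g : ℂ → ℂ, Continuous f ∧ Continuous g ∧ f 0 = a ∧ g 0 = b ∧
      ∀ ε, f ε * g ε + ε ^ 2 * γ = 0 := by
  by_cases hb : b = 0
  · by_cases ha : a = 0
    · exact ⟨fun ε => ε, fun ε => -(ε * γ), by fun_prop, by fun_prop, ha.symm, by simp [hb],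
        fun ε => by ring⟩
    · exact ⟨fun _ => a, fun ε => -(ε ^ 2 * γ) / a, by fun_prop, by fun_prop, rfl, by simp [hb],
        fun ε => by field_simp; ring⟩
  · have ha : a = 0 := (mul_eq_zero.1 h).resolve_right hb
    exact ⟨fun ε => -(ε ^ 2 * γ) / b, fun _ => b, by fun_prop, by fun_prop, by simp [ha], rfl,
      fun ε => by field_simp; ring⟩

/-- The rank-one case is the limit of rank two: the frame is approached by frames on the scaled cone
with $\delta=\varepsilon^2\to0$, and vanishing passes to the limit. -/
theorem eval_eq_zero_of_degenerate_cone {F : MvPolynomial (EntryVar (m + 2) N) ℂ}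
    (hF : F ∈ paramIdeal m N) (H G : Matrix (Fin (m + 2)) (Fin (m + 2)) ℂ)
    (α β : Fin N → Fin (m + 2) → ℂ) (h : ∀ n, α n 0 * β n 0 = 0) :
    eval (ofCols (fun n => H.mulVec (α n)) (fun n => G.mulVec (β n))) F = 0 := by
  choose f g hf hg hf0 hg0 hfg using fun n => exists_curve (α n 1 * β n 1) (h n)
  set φ : ℂ → ℂ := fun ε => eval (ofCols (fun n => H.mulVec (Function.update (α n) 0 (f n ε)))
    (fun n => G.mulVec (Function.update (β n) 0 (g n ε)))) F with hφ
  have hcont : Continuous φ := by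
    refine (MvPolynomial.continuous_eval F).comp (continuous_pi fun v => ?_)
    rcases v with ⟨j, n⟩ | ⟨j, n⟩
    · simp only [ofCols, Sum.elim_inl, Matrix.mulVec, dotProduct]
      refine continuous_finsetSum _ fun i _ => continuous_const.mul ?_
      exact (continuous_apply i).comp (continuous_const.update 0 (hf n))
    · simp only [ofCols, Sum.elim_inr, Matrix.mulVec, dotProduct]
      refine continuous_finsetSum _ fun i _ => continuous_const.mul ?_
      exact (continuous_apply i).comp (continuous_const.update 0 (hg n))
  have hzero : ∀ ε ∈ ({0}ᶜ : Set ℂ), φ ε = (fun _ => (0 : ℂ)) ε := by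
    intro ε hε
    refine eval_eq_zero_of_scaled_cone hF H G _ _ (δ := ε ^ 2) (pow_ne_zero 2 hε) fun n => ?_
    simpa using hfg n ε
  have hall : φ = fun _ => 0 :=
    Continuous.ext_on (dense_compl_singleton (0 : ℂ)) hcont continuous_const hzero
  have := congrFun hall 0
  simp only [hφ, hf0, hg0, Function.update_eq_self] at this
  exact this

theorem exists_pair_of_rank_diagonal_le {D : Fin (m + 2) → ℂ} (hD0 : D ≠ 0)
    (hD : (Matrix.diagonal D).rank ≤ 2) :
    ∃ i₀ i₁, i₀ ≠ i₁ ∧ D i₀ ≠ 0 ∧ ∀ i, i ≠ i₀ → i ≠ i₁ → D i = 0 := by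
  classical
  rw [Matrix.rank_diagonal, Fintype.card_subtype] at hD
  obtain ⟨T, hT, hcard⟩ := Finset.exists_superset_card_eq hD (by simp)
  obtain ⟨a, b, hab, rfl⟩ := Finset.card_eq_two.1 hcard
  have hzero : ∀ i, i ≠ a → i ≠ b → D i = 0 := by
    intro i ha hb
    by_contra h
    have := hT (Finset.mem_filter.2 ⟨Finset.mem_univ i, h⟩)
    simp [ha, hb] at this
  by_cases ha : D a = 0
  · refine ⟨b, a, hab.symm, fun hb => hD0 (funext fun i => ?_), fun i h1 h2 => hzero i h2 h1⟩
    by_cases h1 : i = a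
    · rw [h1, ha]; rfl
    · by_cases h2 : i = b
      · rw [h2, hb]; rfl
      · exact hzero i h1 h2
  · exact ⟨a, b, hab, ha, hzero⟩

theorem exists_perm_zero_one {i₀ i₁ : Fin (m + 2)} (h : i₀ ≠ i₁) :
    ∃ π : Equiv.Perm (Fin (m + 2)), π 0 = i₀ ∧ π 1 = i₁ := by
  refine ⟨(Equiv.swap 1 (Equiv.swap 0 i₀ i₁)).trans (Equiv.swap 0 i₀), ?_, ?_⟩
  · have h0 : (0 : Fin (m + 2)) ≠ Equiv.swap 0 i₀ i₁ := by
      intro h0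
      have := congrArg (Equiv.swap 0 i₀) h0
      rw [Equiv.swap_apply_self, Equiv.swap_apply_left] at this
      exact h this
    rw [Equiv.trans_apply, Equiv.swap_apply_of_ne_of_ne (by simp) h0, Equiv.swap_apply_left]
  · simp

/-- Transvections diagonalize `Q`, and a permutation puts its possibly nonzero entries first. In the
new coordinates the equations say that each column pair lies on a scaled cone, degenerate when `Q`
has rank one. -/
theorem eval_eq_zero_of_hasLowRankSolution {F : MvPolynomial (EntryVar (m + 2) N) ℂ}
    (hF : F ∈ paramIdeal m N) {y : EntryVar (m + 2) N → ℂ} (hy : HasLowRankSolution y) :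
    eval y F = 0 := by
  obtain ⟨Q, hQ0, hQ2, hQ⟩ := hy
  obtain ⟨L, L', D, hLD⟩ := Matrix.Pivot.exists_list_transvec_mul_diagonal_mul_list_transvec Q
  set P := (L.map Matrix.TransvectionStruct.toMatrix).prod with hP
  set P' := (L'.map Matrix.TransvectionStruct.toMatrix).prod with hP'
  have hdet : IsUnit P.det := by
    rw [hP, Matrix.TransvectionStruct.det_toMatrix_prod]
    exact isUnit_one
  have hdet' : IsUnit P'.det := by
    rw [hP', Matrix.TransvectionStruct.det_toMatrix_prod]
    exact isUnit_one
  have hD0 : D ≠ 0 := by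
    rintro rfl
    apply hQ0
    rw [hLD]
    simp
  have hD2 : (Matrix.diagonal D).rank ≤ 2 := by
    rw [hLD, Matrix.rank_mul_eq_left_of_isUnit_det _ _ hdet',
      Matrix.rank_mul_eq_right_of_isUnit_det _ _ hdet] at hQ2
    exact hQ2
  obtain ⟨i₀, i₁, hne, hDi₀, hzero⟩ := exists_pair_of_rank_diagonal_le hD0 hD2
  obtain ⟨π, hπ0, hπ1⟩ := exists_perm_zero_one hne
  set α : Fin N → Fin (m + 2) → ℂ := fun n i => P'.mulVec (leftCol y n) (π i) with hα
  set β : Fin N → Fin (m + 2) → ℂ := fun n i => P.transpose.mulVec (rightCol y n) (π i) with hβ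
  have hcond : ∀ n, α n 0 * β n 0 + D i₁ / D i₀ * (α n 1 * β n 1) = 0 := by
    intro n
    have h := hQ n
    rw [matrixEval_linForm_eq_dotProduct, hLD, ← Matrix.mulVec_mulVec, ← Matrix.mulVec_mulVec,
      Matrix.dotProduct_mulVec, ← Matrix.mulVec_transpose] at h
    have h2 : P.transpose.mulVec (rightCol y n) ⬝ᵥ
        (Matrix.diagonal D).mulVec (P'.mulVec (leftCol y n)) =
        D i₀ * (α n 0 * β n 0) + D i₁ * (α n 1 * β n 1) := by
      rw [dotProduct, Finset.sum_eq_add_of_mem i₀ i₁ (Finset.mem_univ _) (Finset.mem_univ _) hne]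
      · simp only [Matrix.mulVec_diagonal, hα, hβ, hπ0, hπ1]
        ring
      · rintro i - ⟨h1, h2⟩
        simp [Matrix.mulVec_diagonal, hzero i h1 h2]
    rw [h2] at h
    field_simp
    linear_combination h
  have hcols : y = ofCols
      (fun n => (Matrix.of fun j i => P'⁻¹ j (π i)).mulVec (α n))
      (fun n => (Matrix.of fun j i => P.transpose⁻¹ j (π i)).mulVec (β n)) := by
    rw [← ofCols_leftCol_rightCol y]
    congr 1
    · ext n j
      have h : P'⁻¹.mulVec (P'.mulVec (leftCol y n)) = leftCol y n := by
        rw [Matrix.mulVec_mulVec, Matrix.nonsing_inv_mul _ hdet', Matrix.one_mulVec]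
      rw [← congrFun h j]
      exact (Equiv.sum_comp π fun i => P'⁻¹ j i * P'.mulVec (leftCol y n) i).symm
    · ext n j
      have h : P.transpose⁻¹.mulVec (P.transpose.mulVec (rightCol y n)) = rightCol y n := by
        rw [Matrix.mulVec_mulVec, Matrix.nonsing_inv_mul _ (by rwa [Matrix.det_transpose]),
          Matrix.one_mulVec]
      rw [← congrFun h j]
      exact (Equiv.sum_comp π
        fun i => P.transpose⁻¹ j i * P.transpose.mulVec (rightCol y n) i).symm
  rw [hcols]
  by_cases hδ : D i₁ / D i₀ = 0
  · refine eval_eq_zero_of_degenerate_cone hF _ _ α β fun n => ?_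
    have := hcond n
    rwa [hδ, zero_mul, add_zero] at this
  · exact eval_eq_zero_of_scaled_cone hF _ _ α β hδ hcond

theorem coneLeft_mul_coneRight (c d : Fin (m + 2) → ℂ) :
    coneLeft c d 0 * coneRight c d 0 + coneLeft c d 1 * coneRight c d 1 = 0 := by
  simp only [coneLeft, coneRight, if_true]
  rw [if_neg (by simp), if_neg (by simp)]
  ring

/-- The witness $G^{-T}\,\mathrm{diag}(1,1,0,\dots,0)\,H^{-1}$ undoes the two changes of coordinates
and leaves the cone equation. -/
theorem hasLowRankSolution_paramPoint (q : ParamVar (m + 2) N → ℂ)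
    {H G : Matrix (Fin (m + 2)) (Fin (m + 2)) ℂ}
    (hH : H = Matrix.of fun j i => q (Sum.inl (Sum.inl (j, i))))
    (hG : G = Matrix.of fun j i => q (Sum.inl (Sum.inr (j, i))))
    (hHdet : IsUnit H.det) (hGdet : IsUnit G.det) : HasLowRankSolution (paramPoint q) := by
  set D : Fin (m + 2) → ℂ := fun i => if i = 0 ∨ i = 1 then 1 else 0 with hD
  have hGt : IsUnit G.transpose.det := by rwa [Matrix.det_transpose]
  refine ⟨G.transpose⁻¹ * Matrix.diagonal D * H⁻¹, ?_, ?_, fun n => ?_⟩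
  · intro h0
    have h1 : G.transpose * (G.transpose⁻¹ * Matrix.diagonal D * H⁻¹) * H =
        Matrix.diagonal D := by
      rw [← Matrix.mul_assoc, ← Matrix.mul_assoc, Matrix.mul_nonsing_inv _ hGt, Matrix.one_mul,
        Matrix.mul_assoc, Matrix.nonsing_inv_mul _ hHdet, Matrix.mul_one]
    rw [h0, Matrix.mul_zero, Matrix.zero_mul] at h1
    have := congrFun (congrFun h1 0) 0
    simp [hD] at this
  · refine (Matrix.rank_mul_le_left _ _).trans ((Matrix.rank_mul_le_right _ _).trans ?_)
    rw [Matrix.rank_diagonal, Fintype.card_subtype]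
    refine (Finset.card_le_card (t := {0, 1}) fun i hi => ?_).trans Finset.card_le_two
    simp only [Finset.mem_filter, hD] at hi
    simp only [Finset.mem_insert, Finset.mem_singleton]
    by_contra hcon
    exact hi.2 (if_neg hcon)
  · have ha : leftCol (paramPoint q) n = H.mulVec (coneLeft
        (fun k => q (Sum.inr (Sum.inl (n, k)))) fun k => q (Sum.inr (Sum.inr (n, k)))) := by
      rw [hH]; rfl
    have hb : rightCol (paramPoint q) n = G.mulVec (coneRight
        (fun k => q (Sum.inr (Sum.inl (n, k)))) fun k => q (Sum.inr (Sum.inr (n, k)))) := by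
      rw [hG]; rfl
    rw [matrixEval_linForm_eq_dotProduct, ha, hb, Matrix.mulVec_mulVec, Matrix.mul_assoc,
      Matrix.nonsing_inv_mul _ hHdet, Matrix.mul_one, ← Matrix.mulVec_mulVec,
      Matrix.dotProduct_mulVec, ← Matrix.mulVec_transpose, Matrix.mulVec_mulVec,
      Matrix.transpose_nonsing_inv, Matrix.transpose_transpose,
      Matrix.nonsing_inv_mul _ hGdet, Matrix.one_mulVec, dotProduct,
      Finset.sum_eq_add_of_mem (0 : Fin (m + 2)) 1 (Finset.mem_univ _) (Finset.mem_univ _)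
        (by simp)]
    · simp only [Matrix.mulVec_diagonal, hD, true_or, or_true, if_true]
      linear_combination coneLeft_mul_coneRight (fun k => q (Sum.inr (Sum.inl (n, k))))
        (fun k => q (Sum.inr (Sum.inr (n, k))))
    · rintro i - ⟨h1, h2⟩
      simp [Matrix.mulVec_diagonal, hD, h1, h2]

/-- The parametrization is known to land in the locus only where `H` and `G` are invertible.
Multiplying the pulled-back polynomial by both determinants makes it vanish everywhere, and the
determinants cancel in a domain. -/
theorem mem_paramIdeal {F : MvPolynomial (EntryVar (m + 2) N) ℂ}
    (hF : ∀ y, HasLowRankSolution y → eval y F = 0) : F ∈ paramIdeal m N := by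
  set H : Matrix (Fin (m + 2)) (Fin (m + 2)) (MvPolynomial (ParamVar (m + 2) N) ℂ) :=
    Matrix.of fun j i => X (Sum.inl (Sum.inl (j, i))) with hH
  set G : Matrix (Fin (m + 2)) (Fin (m + 2)) (MvPolynomial (ParamVar (m + 2) N) ℂ) :=
    Matrix.of fun j i => X (Sum.inl (Sum.inr (j, i))) with hG
  have hHq : ∀ q, eval q H.det = (Matrix.of fun j i => q (Sum.inl (Sum.inl (j, i)))).det := by
    intro q
    rw [RingHom.map_det]
    congr 1
    ext i j
    simp [hH]
  have hGq : ∀ q, eval q G.det = (Matrix.of fun j i => q (Sum.inl (Sum.inr (j, i)))).det := by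
    intro q
    rw [RingHom.map_det]
    congr 1
    ext i j
    simp [hG]
  have hone : (Matrix.of fun j i : Fin (m + 2) =>
      (1 : Matrix (Fin (m + 2)) (Fin (m + 2)) ℂ) j i) = 1 := rfl
  have hH0 : H.det ≠ 0 := by
    intro h
    have := hHq (Sum.elim (Sum.elim (fun p => (1 : Matrix _ _ ℂ) p.1 p.2) 0) 0)
    simp only [Sum.elim_inl] at this
    rw [h, map_zero, hone, Matrix.det_one] at this
    exact zero_ne_one this
  have hG0 : G.det ≠ 0 := by
    intro h
    have := hGq (Sum.elim (Sum.elim 0 (fun p => (1 : Matrix _ _ ℂ) p.1 p.2)) 0)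
    simp only [Sum.elim_inl, Sum.elim_inr] at this
    rw [h, map_zero, hone, Matrix.det_one] at this
    exact zero_ne_one this
  have hprod : aeval (R := ℂ) (paramPoint (X (R := ℂ) : ParamVar (m + 2) N → _)) F *
      (H.det * G.det) = 0 := by
    refine MvPolynomial.funext fun q => ?_
    rw [map_mul, map_mul, eval_aeval_paramPoint, hHq, hGq, map_zero]
    by_cases h1 : (Matrix.of fun j i => q (Sum.inl (Sum.inl (j, i)))).det = 0
    · rw [h1, zero_mul, mul_zero]
    · by_cases h2 : (Matrix.of fun j i => q (Sum.inl (Sum.inr (j, i)))).det = 0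
      · rw [h2, mul_zero, mul_zero]
      · rw [hF _ (hasLowRankSolution_paramPoint q rfl rfl (Ne.isUnit h1) (Ne.isUnit h2)), zero_mul]
  exact (mul_eq_zero.1 hprod).resolve_right (mul_ne_zero hH0 hG0)

end PhaseRetrieval

/-! ### All variables but one are unconstrained on the locus -/

namespace PhaseRetrieval

open MvPolynomial Filter Topology

theorem eq_zero_of_eventually_eval_eq_zero {σ : Type*} [Finite σ] {G : MvPolynomial σ ℂ}
    {z₀ : σ → ℂ} (h : ∀ᶠ z in 𝓝 z₀, eval z G = 0) : G = 0 := by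
  have := Fintype.ofFinite σ
  obtain ⟨r, hr, hball⟩ := Metric.eventually_nhds_iff_ball.1 h
  refine MvPolynomial.funext_set (fun i => Metric.ball (z₀ i) r)
    (fun i => infinite_of_mem_nhds (z₀ i) (Metric.ball_mem_nhds _ hr)) fun z hz => ?_
  rw [map_zero]
  refine hball z ?_
  rw [ball_pi _ hr]
  exact hz

/-- Positions in the first two rows or columns, except the corner. -/
abbrev HookEntry (m : ℕ) : Type :=
  {p : Fin (m + 2) × Fin (m + 2) // ¬(2 ≤ (p.1 : ℕ) ∧ 2 ≤ (p.2 : ℕ)) ∧ p ≠ (0, 0)}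

/-- The tangent space of the rank-two locus at $\mathrm{diag}(1,1,0,\dots,0)$ is supported on the
first two rows and columns and has dimension $4m+4$. Leaving out the corner accounts for scaling, so
$N-1$ forms remain to be matched. -/
theorem card_hookEntry (m : ℕ) : Fintype.card (HookEntry m) = 4 * m + 3 := by
  have h1 : Fintype.card
      {p : Fin (m + 2) × Fin (m + 2) // ¬(2 ≤ (p.1 : ℕ) ∧ 2 ≤ (p.2 : ℕ))} = 4 * m + 4 := by
    rw [Fintype.card_subtype_compl, card_innerEntries, Fintype.card_prod, Fintype.card_fin,
      Nat.add_sub_cancel]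
    have : (m + 2) * (m + 2) = 4 * m + 4 + m ^ 2 := by ring
    omega
  have h2 := Fintype.card_congr (Equiv.subtypeSubtypeEquivSubtypeInter
    (fun p : Fin (m + 2) × Fin (m + 2) => ¬(2 ≤ (p.1 : ℕ) ∧ 2 ≤ (p.2 : ℕ))) (fun p => p ≠ (0, 0)))
  refine h2.symm.trans ?_
  have h3 := Fintype.card_subtype_compl (fun p : {p : Fin (m + 2) × Fin (m + 2) //
    ¬(2 ≤ (p.1 : ℕ) ∧ 2 ≤ (p.2 : ℕ))} => p.1 = (0, 0))
  have h4 : Fintype.card {p : {p : Fin (m + 2) × Fin (m + 2) //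
      ¬(2 ≤ (p.1 : ℕ) ∧ 2 ≤ (p.2 : ℕ))} // p.1 = (0, 0)} = 1 := by
    rw [Fintype.card_eq_one_iff]
    refine ⟨⟨⟨(0, 0), by simp⟩, rfl⟩, fun p => Subtype.ext (Subtype.ext p.2)⟩
  rw [h1, h4] at h3
  exact h3

theorem exists_hookEquiv {m N : ℕ} (hN : N = 4 * m + 4) (n₀ : Fin N) :
    Nonempty ({n : Fin N // n ≠ n₀} ≃ HookEntry m) := by
  refine ⟨Fintype.equivOfCardEq ?_⟩
  rw [card_hookEntry, Fintype.card_subtype_compl, Fintype.card_fin, Fintype.card_subtype_eq]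
  omega

variable {m N : ℕ}

/-- The first column of a rank one form vanishing on `diag(1, 1, 0, …, 0)`. -/
def hookLeft (p : Fin (m + 2) × Fin (m + 2)) : Fin (m + 2) → ℂ :=
  if p.1 = p.2 then Pi.single 0 1 - Pi.single 1 1 else Pi.single p.2 1

/-- The second column of a rank one form vanishing on `diag(1, 1, 0, …, 0)`. -/
def hookRight (p : Fin (m + 2) × Fin (m + 2)) : Fin (m + 2) → ℂ :=
  if p.1 = p.2 then Pi.single 0 1 + Pi.single 1 1 else Pi.single p.1 1

theorem hookEntry_eq_one {p : HookEntry m} (h : p.1.1 = p.1.2) : p.1 = (1, 1) := by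
  obtain ⟨⟨i, j⟩, h1, h2⟩ := p
  change i = j at h
  subst h
  simp only [and_self, not_le] at h1
  have h3 : (i : ℕ) ≠ 0 := fun h => h2 (by rw [show i = 0 from Fin.ext h])
  have : i = 1 := Fin.ext (by rw [Fin.val_one]; omega)
  change (i, i) = (1, 1)
  rw [this]

/-- Off the diagonal the form reads one entry, which is zero at the base matrix. The entry at
$(1,1)$ is not zero there, so the form used for that position is one in which the two diagonal ones
cancel. -/
theorem sum_hook (p : HookEntry m) (T : Fin (m + 2) → Fin (m + 2) → ℂ) :
    ∑ i, ∑ j, hookRight p.1 i * T i j * hookLeft p.1 j =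
      if p.1.1 = p.1.2 then T 0 0 - T 0 1 + T 1 0 - T 1 1 else T p.1.1 p.1.2 := by
  by_cases h : p.1.1 = p.1.2
  · simp only [hookLeft, hookRight, if_pos h, Pi.sub_apply, Pi.add_apply, mul_sub, add_mul,
      Finset.sum_sub_distrib, Finset.sum_add_distrib]
    simp [Pi.single_apply]
    ring
  · simp only [hookLeft, hookRight, if_neg h]
    simp [Pi.single_apply]

/-- The first two columns of the identity matrix. -/
def baseFactor (m : ℕ) (i : Fin (m + 2)) (k : Fin 2) : ℂ := if (i : ℕ) = k then 1 else 0

/-- Varying the left factor produces the first two columns of `T`, and varying the right factor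
produces the rest of the first two rows. -/
theorem exists_factor_variation (T : Fin (m + 2) → Fin (m + 2) → ℂ)
    (hT : ∀ i j : Fin (m + 2), 2 ≤ (i : ℕ) → 2 ≤ (j : ℕ) → T i j = 0) :
    ∃ δX δY : Fin (m + 2) → Fin 2 → ℂ, ∀ i j,
      ∑ k, (δX i k * baseFactor m j k + baseFactor m i k * δY j k) = T i j := by
  refine ⟨fun i k => T i (Fin.castLE (by omega) k),
    fun j k => if 2 ≤ (j : ℕ) then T (Fin.castLE (by omega) k) j else 0, fun i j => ?_⟩
  rw [Fin.sum_univ_two]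
  have hlt : ∀ i : Fin (m + 2), i = 0 ∨ i = 1 ∨ 2 ≤ (i : ℕ) := by
    intro i
    by_cases h0 : (i : ℕ) = 0
    · exact Or.inl (Fin.ext h0)
    · by_cases h1 : (i : ℕ) = 1
      · exact Or.inr (Or.inl (Fin.ext (by rw [Fin.val_one]; exact h1)))
      · exact Or.inr (Or.inr (by omega))
  have e0 : (Fin.castLE (by omega) (0 : Fin 2) : Fin (m + 2)) = 0 := rfl
  have e1 : (Fin.castLE (by omega) (1 : Fin 2) : Fin (m + 2)) = 1 := rfl
  have hb : ∀ i : Fin (m + 2), 2 ≤ (i : ℕ) → ∀ k, baseFactor m i k = 0 := by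
    intro i hi k
    rw [baseFactor, if_neg]
    have := k.2
    omega
  have b00 : baseFactor m 0 0 = 1 := by simp [baseFactor]
  have b01 : baseFactor m 0 1 = 0 := by simp [baseFactor]
  have b10 : baseFactor m 1 0 = 0 := by simp [baseFactor]
  have b11 : baseFactor m 1 1 = 1 := by simp [baseFactor]
  rcases hlt j with rfl | rfl | hj
  · simp [e0, b00, b01]
  · simp [e1, b10, b11]
  · simp only [e0, e1, hb j hj, if_pos hj]
    rcases hlt i with rfl | rfl | hi
    · simp [b00, b01]
    · simp [b10, b11]
    · simp [hb i hi, hT i j hi hj]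

/-- The values of the forms indexed by `n ≠ n₀` at the matrix `X Yᵀ`, together with the forms. -/
def formMap (n₀ : Fin N)
    (p : (Fin (m + 2) → Fin 2 → ℂ) × (Fin (m + 2) → Fin 2 → ℂ) × (EntryVar (m + 2) N → ℂ)) :
    ({n : Fin N // n ≠ n₀} → ℂ) × (EntryVar (m + 2) N → ℂ) :=
  (fun n => ∑ i, ∑ j, p.2.2 (Sum.inr (i, n)) * (∑ k, p.1 i k * p.2.1 j k) *
    p.2.2 (Sum.inl (j, n)), p.2.2)

theorem contDiff_formMap (n₀ : Fin N) : ContDiff ℂ 1 (formMap (m := m) n₀) := by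
  unfold formMap
  fun_prop

/-- Variations of the rank-two matrix already realize arbitrary values of the $N-1$ forms, while the
frame coordinate is copied unchanged. -/
theorem range_fderiv_formMap (n₀ : Fin N) (κ : {n : Fin N // n ≠ n₀} ≃ HookEntry m)
    (y₀ : EntryVar (m + 2) N → ℂ)
    (hleft : ∀ (n : {n : Fin N // n ≠ n₀}) j, y₀ (Sum.inl (j, n)) = hookLeft (κ n).1 j)
    (hright : ∀ (n : {n : Fin N // n ≠ n₀}) i, y₀ (Sum.inr (i, n)) = hookRight (κ n).1 i) :
    (fderiv ℂ (formMap (m := m) n₀) (baseFactor m, baseFactor m, y₀)).range = ⊤ := by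
  set p₀ := (baseFactor m, baseFactor m, y₀) with hp₀
  set L := fderiv ℂ (formMap (m := m) n₀) p₀ with hL
  have hd : HasFDerivAt (formMap (m := m) n₀) L p₀ :=
    ((contDiff_formMap n₀).differentiable one_ne_zero p₀).hasFDerivAt
  have hsnd : ∀ d, (L d).2 = d.2.2 := by
    intro d
    have h1 : HasFDerivAt (fun p => (formMap (m := m) n₀ p).2)
        ((ContinuousLinearMap.snd ℂ _ _).comp L) p₀ := hd.snd
    have h2 : HasFDerivAt (fun p => (formMap (m := m) n₀ p).2)
        ((ContinuousLinearMap.snd ℂ _ _).comp (ContinuousLinearMap.snd ℂ _ _)) p₀ :=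
      ((ContinuousLinearMap.snd ℂ (Fin (m + 2) → Fin 2 → ℂ) (EntryVar (m + 2) N → ℂ)).comp
        (ContinuousLinearMap.snd ℂ (Fin (m + 2) → Fin 2 → ℂ) _)).hasFDerivAt
    exact congrArg (fun f => f d) (h1.unique h2)
  have hfst : ∀ δX δY n, (L (δX, δY, 0)).1 n = ∑ i, ∑ j, hookRight (κ n).1 i *
      (∑ k, (δX i k * baseFactor m j k + baseFactor m i k * δY j k)) * hookLeft (κ n).1 j := by
    intro δX δY n
    have h2 : HasDerivAt (fun t : ℂ => (formMap n₀ (p₀ + t • (δX, δY, 0))).1 n)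
        ((L (δX, δY, 0)).1 n) 0 :=
      (hasFDerivAt_pi'.1 hd.fst n).hasLineDerivAt (δX, δY, 0)
    have h4 : HasDerivAt (fun t : ℂ => ∑ i, ∑ j, hookRight (κ n).1 i *
        (∑ k, (baseFactor m i k + t * δX i k) * (baseFactor m j k + t * δY j k)) *
          hookLeft (κ n).1 j) (∑ i, ∑ j, hookRight (κ n).1 i *
        (∑ k, (δX i k * baseFactor m j k + baseFactor m i k * δY j k)) * hookLeft (κ n).1 j) 0 := by
      refine HasDerivAt.fun_sum fun i _ => HasDerivAt.fun_sum fun j _ => ?_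
      refine HasDerivAt.mul_const (HasDerivAt.const_mul _ (HasDerivAt.fun_sum fun k _ => ?_)) _
      have hx : HasDerivAt (fun t : ℂ => baseFactor m i k + t * δX i k) (δX i k) 0 := by
        simpa using ((hasDerivAt_id (0 : ℂ)).mul_const (δX i k)).const_add (baseFactor m i k)
      have hy : HasDerivAt (fun t : ℂ => baseFactor m j k + t * δY j k) (δY j k) 0 := by
        simpa using ((hasDerivAt_id (0 : ℂ)).mul_const (δY j k)).const_add (baseFactor m j k)
      simpa using hx.fun_mul hy
    refine h2.unique (h4.congr_of_eventuallyEq (Eventually.of_forall fun t => ?_))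
    simp [formMap, hp₀, hleft, hright]
  have hzero : ∀ τ, ∃ d, L d = (τ, 0) := by
    intro τ
    set T : Fin (m + 2) → Fin (m + 2) → ℂ := fun i j =>
      if h : ¬(2 ≤ (i : ℕ) ∧ 2 ≤ (j : ℕ)) ∧ (i, j) ≠ (0, 0) then τ (κ.symm ⟨(i, j), h⟩) else 0
      with hT
    -- The entry at $(1,1)$ is chosen so that $-T_{01}+T_{10}-T'_{11}$ equals the prescribed value
    -- $T_{11}$. The corner $T_{00}$ is zero.
    set T' : Fin (m + 2) → Fin (m + 2) → ℂ := fun i j =>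
      if i = 1 ∧ j = 1 then T 1 0 - T 0 1 - T 1 1 else T i j with hT'
    obtain ⟨δX, δY, hδ⟩ := exists_factor_variation T' (fun i j hi hj => by
      rw [hT']
      simp only
      rw [if_neg]
      · rw [hT]
        simp [hi, hj]
      · rintro ⟨rfl, -⟩
        rw [Fin.val_one] at hi
        omega)
    refine ⟨(δX, δY, 0), Prod.ext (funext fun n => ?_) (hsnd _)⟩
    rw [hfst]
    simp only [hδ]
    rw [sum_hook]
    have hTn : T (κ n).1.1 (κ n).1.2 = τ n := by
      rw [hT]
      simp only
      rw [dif_pos (κ n).2]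
      simp
    split_ifs with h
    · have h11 := hookEntry_eq_one h
      rw [h11] at hTn
      have hT00 : T 0 0 = 0 := by simp [hT]
      simp only [hT']
      simp only [true_and, and_true, and_self, if_true, Fin.zero_eq_one_iff, hT00]
      simp
      linear_combination hTn
    · simp only [hT']
      rw [if_neg]
      · exact hTn
      · rintro ⟨h1, h2⟩
        exact h (h1.trans h2.symm)
  rw [LinearMap.range_eq_top]
  rintro ⟨τ, w⟩
  obtain ⟨d, hd'⟩ := hzero (τ - (L (0, 0, w)).1)
  refine ⟨d + (0, 0, w), ?_⟩
  change L (d + (0, 0, w)) = (τ, w)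
  rw [map_add, hd']
  refine Prod.ext ?_ ?_
  · simp
  · simp [hsnd]

/-- The remaining equation is affine in the updated variable with coefficient $(Qa_{n_0})_0\ne0$, so
it can be solved without affecting the other forms. -/
theorem hasLowRankSolution_update {y : EntryVar (m + 2) N → ℂ} {n₀ : Fin N}
    (X Y : Fin (m + 2) → Fin 2 → ℂ)
    (hforms : ∀ n ≠ n₀, ∑ i, ∑ j, y (Sum.inr (i, n)) * (∑ k, X i k * Y j k) *
      y (Sum.inl (j, n)) = 0)
    (hrow : ∑ j, (∑ k, X 0 k * Y j k) * y (Sum.inl (j, n₀)) ≠ 0) :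
    ∃ v, HasLowRankSolution (Function.update y (Sum.inr (0, n₀)) v) := by
  set Q : Matrix (Fin (m + 2)) (Fin (m + 2)) ℂ := Matrix.of X * (Matrix.of Y).transpose with hQ
  have hQij : ∀ i j, Q i j = ∑ k, X i k * Y j k := fun i j => by
    simp [hQ, Matrix.mul_apply]
  set R : Fin (m + 2) → ℂ := fun i => ∑ j, Q i j * y (Sum.inl (j, n₀)) with hR
  have hR0 : R 0 ≠ 0 := by
    simpa only [hR, hQij] using hrow
  set v : ℂ := -(∑ i ∈ Finset.univ.erase 0, y (Sum.inr (i, n₀)) * R i) / R 0 with hv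
  refine ⟨v, Q, ?_, ?_, fun n => ?_⟩
  · intro h0
    apply hR0
    simp [hR, h0]
  · refine (Matrix.rank_mul_le_left _ _).trans ((Matrix.rank_le_card_width _).trans ?_)
    simp
  · rw [matrixEval_linForm]
    have hl : ∀ j n, Function.update y (Sum.inr (0, n₀)) v (Sum.inl (j, n)) = y (Sum.inl (j, n)) :=
      fun j n => Function.update_of_ne (by simp) _ _
    by_cases hn : n = n₀
    · subst hn
      have h1 : ∀ i, ∑ j, Function.update y (Sum.inr (0, n)) v (Sum.inr (i, n)) *
          Function.update y (Sum.inr (0, n)) v (Sum.inl (j, n)) * Q i j =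
          Function.update y (Sum.inr (0, n)) v (Sum.inr (i, n)) * R i := by
        intro i
        rw [hR, Finset.mul_sum]
        refine Finset.sum_congr rfl fun j _ => ?_
        rw [hl]
        ring
      simp only [h1]
      rw [← Finset.add_sum_erase _ _ (Finset.mem_univ 0), Function.update_self, hv,
        div_mul_cancel₀ _ hR0, neg_add_eq_zero]
      refine Finset.sum_congr rfl fun i hi => ?_
      rw [Function.update_of_ne]
      simpa using Finset.ne_of_mem_erase hi
    · rw [← hforms n hn]
      refine Finset.sum_congr rfl fun i _ => Finset.sum_congr rfl fun j _ => ?_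
      rw [hl, Function.update_of_ne (by simp [hn]), hQij]
      ring

/-- By the surjective form of the inverse function theorem, every frame near `y₀` has a nearby
rank-two factorization annihilating the forms other than `n₀`. Adjusting the omitted variable
repairs the last form, so `G` vanishes on an open set. -/
theorem eq_zero_of_rename_mem_paramIdeal (hN : N = 4 * m + 4) (n₀ : Fin N)
    (G : MvPolynomial {x : EntryVar (m + 2) N // x ≠ Sum.inr (0, n₀)} ℂ)
    (hG : rename Subtype.val G ∈ paramIdeal m N) : G = 0 := by
  classical
  obtain ⟨κ⟩ := exists_hookEquiv hN n₀
  -- Column `n₀` gets $a=e_0$, so that $(Qa)_0=1$ at the base matrix.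
  set y₀ : EntryVar (m + 2) N → ℂ := ofCols
    (fun n => if h : n ≠ n₀ then hookLeft (κ ⟨n, h⟩).1 else Pi.single 0 1)
    (fun n => if h : n ≠ n₀ then hookRight (κ ⟨n, h⟩).1 else 0) with hy₀
  have hrange := range_fderiv_formMap n₀ κ y₀
    (fun n j => by simp [hy₀, ofCols, n.2]) (fun n j => by simp [hy₀, ofCols, n.2])
  have hstrict := (contDiff_formMap (m := m) n₀).contDiffAt
    (x := (baseFactor m, baseFactor m, y₀)) |>.hasStrictFDerivAt one_ne_zero
  have hmap := hstrict.map_nhds_eq_of_surj hrange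
  have hval : formMap n₀ (baseFactor m, baseFactor m, y₀) = (0, y₀) := by
    refine Prod.ext (funext fun n => ?_) rfl
    have h1 : ∀ i j : Fin (m + 2), ∑ k, baseFactor m i k * baseFactor m j k =
        if i = j then if (i : ℕ) < 2 then 1 else 0 else 0 := by
      intro i j
      rw [Fin.sum_univ_two]
      simp only [baseFactor]
      by_cases hij : i = j
      · subst hij
        rw [if_pos rfl]
        rcases (by omega : (i : ℕ) = 0 ∨ (i : ℕ) = 1 ∨ 2 ≤ (i : ℕ)) with h | h | h
        · simp [h]
        · simp [h]
        · rw [Fin.val_zero, Fin.val_one, if_neg (by omega), if_neg (by omega), if_neg (by omega)]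
          ring
      · have hij' : (i : ℕ) ≠ j := fun h => hij (Fin.ext h)
        rw [if_neg hij, Fin.val_zero, Fin.val_one]
        rcases (by omega : (i : ℕ) = 0 ∨ (i : ℕ) ≠ 0) with h | h
        · rw [if_neg (by omega : ¬(j : ℕ) = 0), if_neg (by omega : ¬(i : ℕ) = 1)]
          ring
        · rw [if_neg h]
          rcases (by omega : (i : ℕ) = 1 ∨ (i : ℕ) ≠ 1) with h' | h'
          · rw [if_neg (by omega : ¬(j : ℕ) = 1)]
            ring
          · rw [if_neg h']
            ring
    have h2 := sum_hook (κ n) fun i j => if i = j then if (i : ℕ) < 2 then (1 : ℂ) else 0 else 0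
    simp only [formMap, h1]
    have hn : ∀ i, y₀ (Sum.inr (i, (n : Fin N))) = hookRight (κ n).1 i := fun i => by
      simp [hy₀, ofCols, n.2]
    have hn' : ∀ i, y₀ (Sum.inl (i, (n : Fin N))) = hookLeft (κ n).1 i := fun i => by
      simp [hy₀, ofCols, n.2]
    simp only [hn, hn']
    rw [h2]
    by_cases h : (κ n).1.1 = (κ n).1.2
    · rw [if_pos h]
      simp
    · rw [if_neg h, if_neg h]
      rfl
  have hopen : ∀ᶠ p : (Fin (m + 2) → Fin 2 → ℂ) × (Fin (m + 2) → Fin 2 → ℂ) ×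
      (EntryVar (m + 2) N → ℂ) in 𝓝 (baseFactor m, baseFactor m, y₀),
      ∑ j, (∑ k, p.1 0 k * p.2.1 j k) * p.2.2 (Sum.inl (j, n₀)) ≠ 0 := by
    refine ContinuousAt.eventually_ne (Continuous.continuousAt (by fun_prop)) ?_
    have : ∀ j, y₀ (Sum.inl (j, n₀)) = (Pi.single 0 1 : Fin (m + 2) → ℂ) j := fun j => by
      simp [hy₀, ofCols]
    simp only [this]
    simp [Pi.single_apply, baseFactor]
  have hev : ∀ᶠ q in 𝓝 ((0 : {n : Fin N // n ≠ n₀} → ℂ), y₀), ∃ p, formMap n₀ p = q ∧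
      ∑ j, (∑ k, p.1 (0 : Fin (m + 2)) k * p.2.1 j k) * p.2.2 (Sum.inl (j, n₀)) ≠ 0 := by
    rw [← hval, ← hmap, eventually_map]
    exact hopen.mono fun p hp => ⟨p, rfl, hp⟩
  have hev2 : ∀ᶠ z in 𝓝 (fun x : {x : EntryVar (m + 2) N // x ≠ Sum.inr (0, n₀)} => y₀ x),
      eval z G = 0 := by
    set ext : ({x : EntryVar (m + 2) N // x ≠ Sum.inr (0, n₀)} → ℂ) → EntryVar (m + 2) N → ℂ :=
      fun z x => if h : x ≠ Sum.inr (0, n₀) then z ⟨x, h⟩ else y₀ x with hext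
    have hextc : Continuous ext := by
      refine continuous_pi fun x => ?_
      by_cases hx : x ≠ Sum.inr (0, n₀)
      · simp only [hext, dif_pos hx]
        exact continuous_apply _
      · simp only [hext, dif_neg hx]
        exact continuous_const
    have hext0 : ext (fun x => y₀ x) = y₀ := by
      ext x
      by_cases hx : x ≠ Sum.inr (0, n₀)
      · simp only [hext, dif_pos hx]
      · simp only [hext, dif_neg hx]
    have hcont : Tendsto (fun z => ((0 : {n : Fin N // n ≠ n₀} → ℂ), ext z))
        (𝓝 fun x : {x : EntryVar (m + 2) N // x ≠ Sum.inr (0, n₀)} => y₀ x) (𝓝 (0, y₀)) := by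
      have : Continuous fun z => ((0 : {n : Fin N // n ≠ n₀} → ℂ), ext z) := by fun_prop
      have h2 := this.tendsto fun x => y₀ x
      rwa [hext0] at h2
    filter_upwards [hcont.eventually hev] with z hz
    obtain ⟨⟨X, Y, y⟩, hp, hrow⟩ := hz
    have hy : y = ext z := congrArg Prod.snd hp
    obtain ⟨v, hv⟩ := hasLowRankSolution_update X Y
      (fun n hn => congrFun (congrArg Prod.fst hp) ⟨n, hn⟩) hrow
    have h0 := eval_eq_zero_of_hasLowRankSolution hG hv
    rw [eval_rename] at h0
    rw [← h0]
    congr 2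
    funext x
    rw [Function.comp_apply, Function.update_of_ne x.2, hy]
    simp only [hext, dif_pos x.2]
  exact eq_zero_of_eventually_eval_eq_zero hev2

theorem exists_generator_paramIdeal (hN : N = 4 * m + 4)
    (hne : paramIdeal m N ≠ ⊥) :
    ∃ F ∈ paramIdeal m N, F ≠ 0 ∧ ∀ G ∈ paramIdeal m N, F ∣ G :=
  exists_generator_of_isPrime_mvPolynomial _ hne (Sum.inr (0, ⟨0, by omega⟩))
    fun G hG => eq_zero_of_rename_mem_paramIdeal hN _ G hG

end PhaseRetrieval

/-! ### Column degrees under divisibility and as a multidegree -/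

namespace PhaseRetrieval

open MvPolynomial

section Weights

/-- A new variable records the weight, so weights become degrees in one variable over a domain.
These are additive in products and so bound the factor `F`, which need not be homogeneous. -/
theorem weight_le_of_dvd {σ : Type*} {w : σ → ℕ} {F Δ : MvPolynomial σ ℂ} {d : ℕ}
    (hΔ : IsWeightedHomogeneous w Δ d) (hΔ0 : Δ ≠ 0) (hdvd : F ∣ Δ) {e : σ →₀ ℕ}
    (he : coeff e F ≠ 0) : Finsupp.weight w e ≤ d := by
  classical
  obtain ⟨G, rfl⟩ := hdvd
  let Ψ : MvPolynomial σ ℂ →ₐ[ℂ] Polynomial (MvPolynomial σ ℂ) :=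
    aeval fun v => Polynomial.C (X v) * Polynomial.X ^ w v
  have hmon : ∀ (e : σ →₀ ℕ) (c : ℂ), Ψ (monomial e c) =
      Polynomial.C (monomial e c) * Polynomial.X ^ Finsupp.weight w e := by
    intro e c
    have h1 : Ψ (monomial e c) = algebraMap ℂ _ c *
        ∏ v ∈ e.support, (Polynomial.C (X v) * Polynomial.X ^ w v) ^ e v := aeval_monomial _ _ _
    have h2 : (∏ v ∈ e.support, (Polynomial.X : Polynomial (MvPolynomial σ ℂ)) ^ (w v * e v)) =
        Polynomial.X ^ Finsupp.weight w e := by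
      rw [Finset.prod_pow_eq_pow_sum, Finsupp.weight_apply, Finsupp.sum]
      simp only [smul_eq_mul, mul_comm]
    have h3 : monomial e c = C c * ∏ v ∈ e.support, (X v : MvPolynomial σ ℂ) ^ e v := monomial_eq
    rw [h1, Polynomial.algebraMap_apply, algebraMap_eq, h3, Polynomial.C_mul, map_prod, ← h2,
      mul_assoc, ← Finset.prod_mul_distrib]
    simp only [mul_pow, ← pow_mul, Polynomial.C_pow]
  have hcoeff : ∀ (p : MvPolynomial σ ℂ) (e : σ →₀ ℕ),
      coeff e ((Ψ p).coeff (Finsupp.weight w e)) = coeff e p := by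
    intro p e
    induction p using MvPolynomial.induction_on' with
    | add p q hp hq => rw [map_add, Polynomial.coeff_add, coeff_add, coeff_add, hp, hq]
    | monomial s c =>
      rw [hmon, Polynomial.coeff_C_mul, Polynomial.coeff_X_pow]
      by_cases hs : s = e
      · simp [hs]
      · split_ifs with h
        · rw [mul_one]
        · rw [mul_zero, coeff_zero, coeff_monomial, if_neg hs]
  have hdeg : ∀ p : MvPolynomial σ ℂ, ∀ e, coeff e p ≠ 0 →
      Finsupp.weight w e ≤ (Ψ p).natDegree := by
    intro p e hp
    refine Polynomial.le_natDegree_of_ne_zero fun h => hp ?_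
    rw [← hcoeff, h, coeff_zero]
  have hprod : (Ψ (F * G)).natDegree ≤ d := by
    rw [as_sum (F * G), map_sum]
    refine Polynomial.natDegree_sum_le_of_forall_le _ _ fun e he => ?_
    rw [hmon, hΔ (mem_support_iff.1 he)]
    exact Polynomial.natDegree_C_mul_X_pow_le _ _
  have hinj : ∀ p, p ≠ 0 → Ψ p ≠ 0 := by
    intro p hp h
    obtain ⟨e, he⟩ := ne_zero_iff.1 hp
    apply he
    rw [← hcoeff, h, Polynomial.coeff_zero, coeff_zero]
  rw [map_mul, Polynomial.natDegree_mul (hinj F (left_ne_zero_of_mul hΔ0))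
    (hinj G (right_ne_zero_of_mul hΔ0))] at hprod
  have := hdeg F e he
  omega

theorem isWeightedHomogeneous_aeval {σ τ W R : Type*} [CommSemiring R] [AddCommMonoid W]
    {w : σ → W} {w' : τ → W} {F : MvPolynomial σ R} {d : W} (hF : IsWeightedHomogeneous w F d)
    (f : σ → MvPolynomial τ R) (hf : ∀ v, IsWeightedHomogeneous w' (f v) (w v)) :
    IsWeightedHomogeneous w' (aeval f F) d := by
  rw [as_sum F, map_sum]
  refine IsWeightedHomogeneous.sum _ _ _ fun e he => ?_
  rw [aeval_monomial, ← hF (mem_support_iff.1 he), Finsupp.weight_apply, ← zero_add (Finsupp.sum _ _)]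
  exact (isWeightedHomogeneous_C _ _).mul
    (IsWeightedHomogeneous.prod _ _ _ fun v _ => (hf v).pow (e v))

variable {M N : ℕ}

/-- The column of a variable. -/
def column : EntryVar M N → Fin N
  | Sum.inl p => p.2
  | Sum.inr p => p.2

/-- The multidegree recording the degrees in all columns. -/
noncomputable def multiWeight (v : EntryVar M N) : Fin N →₀ ℕ := Finsupp.single (column v) 1

theorem weight_multiWeight (e : EntryVar M N →₀ ℕ) :
    Finsupp.weight multiWeight e = e.mapDomain column := by
  simp [Finsupp.weight_apply, Finsupp.mapDomain, multiWeight]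

theorem columnWeight_eq (n : Fin N) (v : EntryVar M N) :
    columnWeight n v = multiWeight v n := by
  rcases v with ⟨j, k⟩ | ⟨j, k⟩ <;>
    simp [columnWeight, multiWeight, column, Finsupp.single_apply]

theorem weight_columnWeight (n : Fin N) (e : EntryVar M N →₀ ℕ) :
    Finsupp.weight (columnWeight (M := M) n) e = Finsupp.weight multiWeight e n := by
  simp only [Finsupp.weight_apply, Finsupp.sum, Finsupp.coe_finsetSum, Finset.sum_apply,
    Finsupp.smul_apply, columnWeight_eq]

theorem columnDegree_eq {P : MvPolynomial (EntryVar M N) ℝ} {d : Fin N →₀ ℕ} (hP0 : P ≠ 0)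
    (hP : IsWeightedHomogeneous multiWeight P d) (n : Fin N) : columnDegree n P = d n := by
  have h : IsWeightedHomogeneous (columnWeight (M := M) n) P (d n) := fun e he => by
    rw [weight_columnWeight, hP he]
  have h2 := h.weighted_total_degree hP0
  rw [weightedTotalDegree_coe _ _ hP0] at h2
  exact_mod_cast h2

theorem totalDegree_eq {P : MvPolynomial (EntryVar M N) ℝ} {d : Fin N →₀ ℕ} (hP0 : P ≠ 0)
    (hP : IsWeightedHomogeneous multiWeight P d) : P.totalDegree = ∑ n, d n := by
  have h : P.IsHomogeneous (∑ n, d n) := by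
    intro e he
    rw [← hP he]
    simp only [← weight_columnWeight]
    simp only [Finsupp.weight_apply, Finsupp.sum, smul_eq_mul, Pi.one_apply, mul_one]
    rw [Finset.sum_comm]
    refine Finset.sum_congr rfl fun v _ => ?_
    rw [← Finset.mul_sum]
    rcases v with ⟨j, k⟩ | ⟨j, k⟩ <;> simp [columnWeight]
  exact h.totalDegree hP0

theorem coeff_aeval_column (F : MvPolynomial (EntryVar M N) ℂ) (y : EntryVar M N → ℂ)
    (d : Fin N →₀ ℕ) :
    coeff d (aeval (fun v => C (y v) * X (column v) : EntryVar M N → MvPolynomial (Fin N) ℂ) F) =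
      eval y (weightedHomogeneousComponent multiWeight d F) := by
  classical
  induction F using MvPolynomial.induction_on' with
  | add p q hp hq => rw [map_add, map_add, map_add, coeff_add, hp, hq]
  | monomial e c =>
    have h1 : aeval (fun v => C (y v) * X (column v) : EntryVar M N → MvPolynomial (Fin N) ℂ)
        (monomial e c) = monomial (e.mapDomain column) (eval y (monomial e c)) := by
      have h2 : monomial (e.mapDomain column) (1 : ℂ) =
          e.prod fun v k => (X (column v) : MvPolynomial (Fin N) ℂ) ^ k := by
        rw [← rename_monomial, rename_eq_aeval, aeval_monomial]
        simp
      rw [aeval_monomial, eval_monomial, ← mul_one (c * _), ← C_mul_monomial, h2]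
      simp only [Finsupp.prod, mul_pow, Finset.prod_mul_distrib, map_mul, map_prod, map_pow]
      rw [mul_assoc]
      rfl
    rw [h1, coeff_monomial, ← weight_multiWeight,
      weightedHomogeneousComponent_of_mem (isWeightedHomogeneous_monomial multiWeight e c rfl)]
    by_cases h : Finsupp.weight multiWeight e = d
    · rw [if_pos h, if_pos h.symm]
    · rw [if_neg h, if_neg (Ne.symm h), map_zero]

end Weights

/-! ### Column scaling and conjugation of the locus -/

section Symmetries

variable {M N : ℕ}

theorem HasLowRankSolution.scale {y : EntryVar M N → ℂ} (hy : HasLowRankSolution y)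
    (c : Fin N → ℂ) : HasLowRankSolution fun v => c (column v) * y v := by
  obtain ⟨Q, h0, h2, hQ⟩ := hy
  refine ⟨Q, h0, h2, fun n => ?_⟩
  have h := hQ n
  rw [matrixEval_linForm] at h ⊢
  rw [← mul_zero (c n ^ 2), ← h, Finset.mul_sum]
  refine Finset.sum_congr rfl fun i _ => ?_
  rw [Finset.mul_sum]
  refine Finset.sum_congr rfl fun j _ => ?_
  simp only [column]
  ring

-- Conjugating the equation $b^TQa=0$ gives $\bar a^TQ^*\bar b=0$, so the two columns exchange roles
-- and `Q` becomes its adjoint.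
open scoped ComplexOrder in
theorem HasLowRankSolution.conj {y : EntryVar M N → ℂ} (hy : HasLowRankSolution y) :
    HasLowRankSolution (ofCols (fun n => star (rightCol y n)) (fun n => star (leftCol y n))) := by
  obtain ⟨Q, h0, h2, hQ⟩ := hy
  refine ⟨Q.conjTranspose, fun h => h0 ?_, ?_, fun n => ?_⟩
  · rwa [Matrix.conjTranspose_eq_zero] at h
  · rwa [Matrix.rank_conjTranspose]
  · have h := congrArg (starRingEnd ℂ) (hQ n)
    rw [matrixEval_linForm, map_zero, map_sum] at h
    rw [matrixEval_linForm, Finset.sum_comm, ← h]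
    refine Finset.sum_congr rfl fun i _ => ?_
    rw [map_sum]
    refine Finset.sum_congr rfl fun j _ => ?_
    simp only [ofCols, leftCol, rightCol, Sum.elim_inl, Sum.elim_inr, Matrix.conjTranspose_apply,
      map_mul, Pi.star_apply, Complex.star_def]
    ring

/-- The locus is stable under independent scaling of the columns. As a polynomial in the scaling
factors, `F` vanishes identically, and its coefficients are the values of the multihomogeneous
components. -/
theorem eval_weightedHomogeneousComponent_eq_zero {F : MvPolynomial (EntryVar M N) ℂ}
    (hF : ∀ y, HasLowRankSolution y → eval y F = 0) (d : Fin N →₀ ℕ) {y : EntryVar M N → ℂ}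
    (hy : HasLowRankSolution y) : eval y (weightedHomogeneousComponent multiWeight d F) = 0 := by
  rw [← coeff_aeval_column]
  have h : aeval (fun v => C (y v) * X (column v) : EntryVar M N → MvPolynomial (Fin N) ℂ) F =
      0 := by
    refine MvPolynomial.funext fun c => ?_
    have h1 : (eval c).comp (aeval (fun v => C (y v) * X (column v) :
        EntryVar M N → MvPolynomial (Fin N) ℂ)).toRingHom =
        eval fun v => c (column v) * y v := by
      refine MvPolynomial.ringHom_ext (fun r => by simp) fun v => ?_
      simp [mul_comm]
    have h2 := congrArg (fun f => f F) h1
    rw [map_zero, ← hF _ (hy.scale c)]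
    exact h2
  rw [h, coeff_zero]

end Symmetries

/-- The generator divides the determinant attached to each `n`, so every one of its monomials obeys
all the column bounds simultaneously. The component of any one monomial suffices. -/
theorem exists_multihomogeneous (m : ℕ) :
    ∃ F : MvPolynomial (EntryVar (m + 2) (4 * (m + 2) - 4)) ℂ, F ≠ 0 ∧
      (∀ y, HasLowRankSolution y → eval y F = 0) ∧
      ∃ d : Fin (4 * (m + 2) - 4) →₀ ℕ, IsWeightedHomogeneous multiWeight F d ∧
        ∀ n, d n ≤ 2 * 3 ^ ((m + 2 - 2) ^ 2) := by
  classical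
  choose Δ hΔ0 hΔ δ hδ hΔδ using exists_columnDegree_le (M := m + 2) (by omega)
  have hN : 4 * (m + 2) - 4 = 4 * m + 4 := by omega
  have hne : paramIdeal m (4 * (m + 2) - 4) ≠ ⊥ := by
    intro h
    have hmem := mem_paramIdeal (hΔ ⟨0, by omega⟩)
    rw [h] at hmem
    exact hΔ0 _ hmem
  obtain ⟨F, hF, hF0, hdvd⟩ := exists_generator_paramIdeal hN hne
  obtain ⟨e, he⟩ := ne_zero_iff.1 hF0
  refine ⟨weightedHomogeneousComponent multiWeight (Finsupp.weight multiWeight e) F, ?_,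
    fun y hy => eval_weightedHomogeneousComponent_eq_zero
      (fun y hy => eval_eq_zero_of_hasLowRankSolution hF hy) _ hy,
    _, weightedHomogeneousComponent_isWeightedHomogeneous _ _, fun n => ?_⟩
  · rw [ne_zero_iff]
    refine ⟨e, ?_⟩
    rwa [coeff_weightedHomogeneousComponent, if_pos rfl]
  · rw [← weight_columnWeight]
    exact (weight_le_of_dvd (hΔδ n) (hΔ0 n) (hdvd _ (mem_paramIdeal (hΔ n))) he).trans (hδ n)

/-! ### Return to the variables `U`, `V` and to real coefficients -/

section RealForm

variable {M N : ℕ}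

/-- The passage from `(U, V)` to the columns of `U + iV` and `U - iV`. -/
noncomputable def complexify (x : EntryVar M N → ℂ) : EntryVar M N → ℂ :=
  ofCols (fun n => leftCol x n + Complex.I • rightCol x n)
    (fun n => leftCol x n - Complex.I • rightCol x n)

theorem star_complexify (x : EntryVar M N → ℂ) :
    complexify (star x) = ofCols (fun n => star (rightCol (complexify x) n))
      (fun n => star (leftCol (complexify x) n)) := by
  ext v
  rcases v with ⟨j, n⟩ | ⟨j, n⟩ <;>
    simp [complexify, ofCols, leftCol, rightCol, sub_eq_add_neg]

theorem exists_complexify_eq (y : EntryVar M N → ℂ) : ∃ x, complexify x = y := by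
  refine ⟨ofCols (fun n => (2 : ℂ)⁻¹ • (leftCol y n + rightCol y n))
    (fun n => (-Complex.I / 2) • (leftCol y n - rightCol y n)), ?_⟩
  ext v
  have hI := Complex.I_mul_I
  rcases v with ⟨j, n⟩ | ⟨j, n⟩ <;>
    simp only [complexify, ofCols, leftCol, rightCol, Sum.elim_inl, Sum.elim_inr, Pi.add_apply,
      Pi.sub_apply, Pi.smul_apply, smul_eq_mul]
  · linear_combination (-(1 / 2) * (y (Sum.inl (j, n)) - y (Sum.inr (j, n)))) * hI
  · linear_combination ((1 / 2) * (y (Sum.inl (j, n)) - y (Sum.inr (j, n)))) * hI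

/-- The substitution of `U ± iV` on polynomials. -/
noncomputable def complexifyPoly : EntryVar M N → MvPolynomial (EntryVar M N) ℂ
  | Sum.inl p => X (Sum.inl p) + C Complex.I * X (Sum.inr p)
  | Sum.inr p => X (Sum.inl p) - C Complex.I * X (Sum.inr p)

theorem eval_aeval_complexifyPoly (F : MvPolynomial (EntryVar M N) ℂ) (x : EntryVar M N → ℂ) :
    eval x (aeval complexifyPoly F) = eval (complexify x) F := by
  have h : (eval x).comp (aeval (R := ℂ) (complexifyPoly (M := M) (N := N))).toRingHom =
      eval (complexify x) := by
    refine MvPolynomial.ringHom_ext (fun c => by simp) fun v => ?_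
    rcases v with ⟨j, n⟩ | ⟨j, n⟩ <;>
      simp [complexify, complexifyPoly, ofCols, leftCol, rightCol]
  exact congrArg (fun f => f F) h

theorem isWeightedHomogeneous_complexifyPoly (v : EntryVar M N) :
    IsWeightedHomogeneous multiWeight (complexifyPoly v) (multiWeight v) := by
  have hX : ∀ v : EntryVar M N, IsWeightedHomogeneous multiWeight (X v : MvPolynomial _ ℂ)
      (multiWeight v) := fun v => isWeightedHomogeneous_X ℂ multiWeight v
  have hIX : ∀ v : EntryVar M N, IsWeightedHomogeneous multiWeight
      (C Complex.I * X v : MvPolynomial _ ℂ) (multiWeight v) := fun v => by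
    simpa using (isWeightedHomogeneous_C multiWeight Complex.I).mul (hX v)
  rcases v with ⟨j, n⟩ | ⟨j, n⟩
  · exact (hX (Sum.inl (j, n))).add (hIX (Sum.inr (j, n)))
  · exact (hX (Sum.inl (j, n))).sub (hIX (Sum.inr (j, n)))

/-- On a conjugation-stable set, `F` and its coefficientwise conjugate both vanish, hence so do the
polynomials formed from the real and the imaginary parts of the coefficients. One of the two is
nonzero. -/
theorem exists_real_polynomial {σ W : Type*} [AddCommMonoid W] {w : σ → W} {d : W}
    {F : MvPolynomial σ ℂ} (hF0 : F ≠ 0) (hF : IsWeightedHomogeneous w F d)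
    (Z : Set (σ → ℂ)) (hZ : ∀ x ∈ Z, star x ∈ Z) (hFZ : ∀ x ∈ Z, eval x F = 0) :
    ∃ P : MvPolynomial σ ℝ, P ≠ 0 ∧ IsWeightedHomogeneous w P d ∧ ∀ x ∈ Z, aeval x P = 0 := by
  classical
  set R : (ℂ → ℝ) → MvPolynomial σ ℝ := fun f => ∑ e ∈ F.support, monomial e (f (coeff e F))
    with hR
  have hcoeff : ∀ f : ℂ → ℝ, f 0 = 0 → ∀ e, coeff e (R f) = f (coeff e F) := by
    intro f hf e
    simp only [hR, coeff_sum, coeff_monomial, Finset.sum_ite_eq', mem_support_iff]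
    split_ifs with h
    · rfl
    · rw [not_not.1 h, hf]
  have hhom : ∀ f : ℂ → ℝ, f 0 = 0 → IsWeightedHomogeneous w (R f) d := by
    intro f hf e he
    refine hF fun h => he ?_
    rw [hcoeff f hf, h, hf]
  have hdecomp : F = map Complex.ofRealHom (R Complex.re) +
      C Complex.I * map Complex.ofRealHom (R Complex.im) := by
    ext e
    rw [coeff_add, coeff_C_mul, coeff_map, coeff_map, hcoeff _ rfl, hcoeff _ rfl, mul_comm]
    exact (Complex.re_add_im _).symm
  have hstar : ∀ (P : MvPolynomial σ ℝ) (x : σ → ℂ), aeval (star x) P =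
      starRingEnd ℂ (aeval x P) := by
    intro P x
    have h : aeval (R := ℝ) (star x) = (Complex.conjAe.toAlgHom).comp (aeval (R := ℝ) x) := by
      refine MvPolynomial.algHom_ext fun v => ?_
      simp
    rw [h]
    rfl
  have heval : ∀ x, eval x F = aeval x (R Complex.re) + Complex.I * aeval x (R Complex.im) := by
    intro x
    conv_lhs => rw [hdecomp]
    rw [map_add, map_mul, eval_C, eval_map, eval_map]
    rfl
  have hvan : ∀ x ∈ Z, aeval x (R Complex.re) = 0 ∧ aeval x (R Complex.im) = 0 := by
    intro x hx
    have h1 := hFZ x hx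
    have h2 := congrArg (starRingEnd ℂ) (hFZ _ (hZ x hx))
    rw [heval] at h1 h2
    rw [map_add, map_mul, hstar, hstar, Complex.conj_conj, Complex.conj_conj, Complex.conj_I,
      map_zero] at h2
    constructor
    · linear_combination (h1 + h2) / 2
    · have hI : Complex.I ≠ 0 := Complex.I_ne_zero
      refine (mul_eq_zero.1 (?_ : Complex.I * aeval x (R Complex.im) = 0)).resolve_left hI
      linear_combination (h1 - h2) / 2
  by_cases hre : R Complex.re = 0
  · refine ⟨R Complex.im, fun him => hF0 ?_, hhom _ rfl, fun x hx => (hvan x hx).2⟩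
    rw [hdecomp, hre, him]
    simp
  · exact ⟨R Complex.re, hre, hhom _ rfl, fun x hx => (hvan x hx).1⟩

theorem dotProduct_mulVec_swap {n : ℕ} (A : Matrix (Fin n) (Fin n) ℂ) (u v : Fin n → ℂ) :
    v ⬝ᵥ A.mulVec u = u ⬝ᵥ A.transpose.mulVec v := by
  rw [Matrix.dotProduct_mulVec, ← Matrix.mulVec_transpose, dotProduct_comm]

theorem dotProduct_mulVec_complexify {n : ℕ} {X Y : Matrix (Fin n) (Fin n) ℂ}
    (hX : X.transpose = X) (hY : Y.transpose = -Y) (u v : Fin n → ℂ) :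
    (u - Complex.I • v) ⬝ᵥ (X + Complex.I • Y).mulVec (u + Complex.I • v) =
      u ⬝ᵥ X.mulVec u + v ⬝ᵥ X.mulVec v - 2 * (u ⬝ᵥ Y.mulVec v) := by
  have h1 := dotProduct_mulVec_swap X u v
  have h2 := dotProduct_mulVec_swap Y u v
  have h3 := dotProduct_mulVec_swap Y u u
  have h4 := dotProduct_mulVec_swap Y v v
  rw [hX] at h1
  rw [hY, Matrix.neg_mulVec, dotProduct_neg] at h2 h3 h4
  have h3' : u ⬝ᵥ Y.mulVec u = 0 := by linear_combination h3 / 2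
  have h4' : v ⬝ᵥ Y.mulVec v = 0 := by linear_combination h4 / 2
  simp only [Matrix.add_mulVec, Matrix.mulVec_add, Matrix.smul_mulVec, Matrix.mulVec_smul,
    sub_dotProduct, dotProduct_add, smul_dotProduct, dotProduct_smul, smul_eq_mul, h1, h2, h3', h4']
  linear_combination (u ⬝ᵥ Y.mulVec v * 2 - v ⬝ᵥ X.mulVec v) * Complex.I_mul_I

theorem hasLowRankSolution_of_incidenceConditions {w : FramePair M N} {z : SymSkewPair M}
    (hz : z ≠ 0) (h : IncidenceConditions w z) : HasLowRankSolution (complexify (entries w)) := by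
  obtain ⟨hrank, hforms⟩ := h
  have hX : (z.1 : Matrix (Fin M) (Fin M) ℂ).transpose = z.1 := z.1.2
  have hY : (z.2 : Matrix (Fin M) (Fin M) ℂ).transpose = -z.2 := z.2.2
  refine ⟨_, fun h0 => hz ?_, hrank, fun n => ?_⟩
  · have h1 := congrArg Matrix.transpose h0
    rw [Matrix.transpose_add, Matrix.transpose_smul, hX, hY, Matrix.transpose_zero] at h1
    have hX0 : (z.1 : Matrix (Fin M) (Fin M) ℂ) = 0 := by
      have h2 := congrArg₂ (· + ·) h0 h1
      simp only [smul_neg, add_zero] at h2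
      have h3 : (2 : ℂ) • (z.1 : Matrix (Fin M) (Fin M) ℂ) = 0 := by
        rw [two_smul, ← h2]
        abel
      exact (smul_eq_zero.1 h3).resolve_left two_ne_zero
    have hY0 : (z.2 : Matrix (Fin M) (Fin M) ℂ) = 0 := by
      rw [hX0, zero_add] at h0
      exact (smul_eq_zero.1 h0).resolve_left Complex.I_ne_zero
    exact Prod.ext (Subtype.ext hX0) (Subtype.ext hY0)
  · rw [matrixEval_linForm_eq_dotProduct, ← hforms n]
    exact dotProduct_mulVec_complexify hX hY (w.1.col n) (w.2.col n)

end RealForm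

end PhaseRetrieval

/-! ### Adjustment to the exact degrees -/

namespace PhaseRetrieval

open MvPolynomial

theorem exists_vanishing_polynomial (m : ℕ) :
    ∃ P : MvPolynomial (EntryVar (m + 2) (4 * (m + 2) - 4)) ℝ, P ≠ 0 ∧
      (∀ p ∈ projectedVariety (m + 2) (4 * (m + 2) - 4), VanishesAt P p) ∧
      IsWeightedHomogeneous multiWeight P
        (Finsupp.equivFunOnFinite.symm fun _ => 2 * 3 ^ ((m + 2 - 2) ^ 2)) := by
  obtain ⟨F, hF0, hF, d, hd, hle⟩ := exists_multihomogeneous m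
  obtain ⟨P, hP0, hP, hPZ⟩ := exists_real_polynomial (F := aeval complexifyPoly F)
    (fun h => hF0 <| MvPolynomial.funext fun y => by
      obtain ⟨x, rfl⟩ := exists_complexify_eq y
      rw [← eval_aeval_complexifyPoly, h, map_zero, map_zero])
    (isWeightedHomogeneous_aeval hd _ isWeightedHomogeneous_complexifyPoly)
    {x | HasLowRankSolution (complexify x)}
    (fun x hx => by
      change HasLowRankSolution (complexify (star x))
      rw [star_complexify]
      exact HasLowRankSolution.conj hx)
    (fun x hx => by
      rw [eval_aeval_complexifyPoly]
      exact hF _ hx)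
  -- Only upper bounds on the column degrees are known. A power of one variable from each column
  -- raises them to the exact value without losing the vanishing.
  refine ⟨P * ∏ n, X (Sum.inl (0, n)) ^ (2 * 3 ^ ((m + 2 - 2) ^ 2) - d n),
    mul_ne_zero hP0 (Finset.prod_ne_zero_iff.2 fun n _ => pow_ne_zero _ (X_ne_zero _)), ?_, ?_⟩
  · rintro _ ⟨⟨p, z⟩, hpz, rfl⟩ w hw hwp
    rw [map_mul, hPZ (entries w), zero_mul]
    have hz : Projectivization.mk ℂ z.rep z.rep_nonzero = z := z.mk_rep
    change Projectivization.mk ℂ w hw = p at hwp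
    rw [← hz, ← hwp, mk_mem_incidenceVariety] at hpz
    exact hasLowRankSolution_of_incidenceConditions z.rep_nonzero hpz
  · have hprod : IsWeightedHomogeneous (multiWeight (M := m + 2) (N := 4 * (m + 2) - 4))
        (∏ n, X (Sum.inl (0, n)) ^ (2 * 3 ^ ((m + 2 - 2) ^ 2) - d n) : MvPolynomial _ ℝ)
        (∑ n, (2 * 3 ^ ((m + 2 - 2) ^ 2) - d n) • multiWeight (Sum.inl (0, n))) :=
      IsWeightedHomogeneous.prod _ _ _ fun n _ => (isWeightedHomogeneous_X ℝ _ _).pow _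
    convert hP.mul hprod using 1
    ext n
    rw [Finsupp.add_apply, Finsupp.finsetSum_apply, Finset.sum_eq_single n]
    · simp only [multiWeight, column, Finsupp.smul_apply, Finsupp.single_eq_same, smul_eq_mul,
        mul_one, Finsupp.equivFunOnFinite_symm_apply_apply]
      have := hle n
      omega
    · intro k _ hk
      simp [multiWeight, column, hk]
    · simp

end PhaseRetrieval

theorem proposition4p1 (M : ℕ) (hM : 1 ≤ M) :
    ∃ P : MvPolynomial (PhaseRetrieval.EntryVar M (4 * M - 4)) ℝ,
      P ≠ 0 ∧
      (∀ p ∈ PhaseRetrieval.projectedVariety M (4 * M - 4), PhaseRetrieval.VanishesAt P p) ∧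
      P.totalDegree = 2 * (4 * M - 4) * 3 ^ ((M - 2) ^ 2) ∧
      ∀ n : Fin (4 * M - 4),
        PhaseRetrieval.columnDegree n P = 2 * 3 ^ ((M - 2) ^ 2) := by
  obtain rfl | ⟨m, rfl⟩ : M = 1 ∨ ∃ m, M = m + 2 := by
    rcases Nat.lt_or_ge M 2 with h | h
    · exact Or.inl (by omega)
    · exact Or.inr ⟨M - 2, by omega⟩
  -- For $M=1$ there are no columns, so no nonzero pair exists, and the required total degree is
  -- zero.
  · refine ⟨1, one_ne_zero, fun p _ w hw => ?_, by simp, fun n => n.elim0⟩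
    refine absurd (Prod.ext ?_ ?_) hw <;> exact Matrix.ext fun _ n => n.elim0
  · obtain ⟨P, hP0, hPvan, hP⟩ := PhaseRetrieval.exists_vanishing_polynomial m
    refine ⟨P, hP0, hPvan, ?_, fun n => ?_⟩
    · rw [PhaseRetrieval.totalDegree_eq hP0 hP]
      simp only [Finsupp.equivFunOnFinite_symm_apply_apply, Finset.sum_const, Finset.card_univ,
        Fintype.card_fin, smul_eq_mul]
      ring
    · rw [PhaseRetrieval.columnDegree_eq hP0 hP]
      simp
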